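/- **Model.** Let $M\ge 2$ and consider arms $a_1,\dots,a_M$ with Bernoulli rewards of means $\mu(a_i)\in[0,1]$, and abandonment probabilities $q(s,r)\in[0,1]$ for $s,r\in\{0,1\}$. Users visit in episodes $k=1,2,\dots$. Episode $k$ starts in a state $S_{k,1}\in\{0,1\}$; the sequence $(S_{k,1})_k$ of initial states has an arbitrary law and is independent of everything else. At each step $h\ge 1$ the learner, knowing the current state $S_{k,h}\in\{0,1\}$ and all past samples, pulls an arm $A_{k,h}$ and obtains a reward $R_{k,h}\in\{0,1\}$ of mean $\mu(A_{k,h})$, independent of the past given $A_{k,h}$. Then, with probability $q(S_{k,h},R_{k,h})$, the user abandons and the episode ends; otherwise $S_{k,h+1}=R_{k,h}$ and the episode goes on. For a deterministic policy $\pi$, let $\mathbb E[\mathrm{Reg}_\pi(K)]$ be the expected total reward during the first $K$ episodes when $a_1$ is always pulled, minus the expected total reward during the first $K$ episodes under $\pi$. Let $V^*(s)$ be the expected total reward of one episode that starts in state $s$ when $a_1$ is always pulled, and $Q^*(s,a)$ the same when $a$ is pulled at the first step and $a_1$ at all later steps. Let $\mathrm{kl}(p,p')\in[0,\infty]$ be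 the Kullback–Leibler divergence between the Bernoulli distributions of parameters $p$ and $p'$. **KL-ULCB algorithm** (parameters $c_0,c_1,c$). Let $t=1,2,\dots$ count the time steps over all episodes, let $N_t(a)$ be the number of pulls of arm $a$ before step $t$, and $\bar\mu_t(a)$ the average of the rewards obtained from these pulls. At step $t$, if some arm has $N_t(a)=0$, pull such an arm. Otherwise pull an arm that maximizes $\tilde\mu^{s}_t(a)$ over $a$ (ties are broken arbitrarily), where $s$ is the current state and $$\tilde\mu^0_t(a)=\min\{p\in[0,1]:\mathrm{kl}(\bar\mu_t(a),p)N_t(a)\le c_0\log t+c\log\log t\},$$ $$\tilde\mu^1_t(a)=\max\{p\in[0,1]:\mathrm{kl}(\bar\mu_t(a),p)N_t(a)\le c_1\log t+c\log\log t\}.$$ **Theorem.** Assume that $q(i,j)\ge q(i',j')$ whenever $i+j<i'+j'$, that $q(0,0)>0$, $q(0,1)<1$, $q(1,1)<1$, that $0<\mu(a_M)\le\dots\le\mu(a_2)<\mu(a_1)<1$, and that $V^*(0)-Q^*(0,a)\ge V^*(1)-Q^*(1,a)$ for every arm $a\ne a_1$. Let $\pi$ be the KL-ULCB algorithm with $c_0=c_1=1$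 and $c=4$. Then, for every $K$, the expected total rewards during the first $K$ episodes under $\pi$ and when $a_1$ is always pulled are finite, and $$\limsup_{K\to\infty}\frac{\mathbb E[\mathrm{Reg}_\pi(K)]}{\log K}\le\sum_{i\ne 1}\frac{V^*(1)-Q^*(1,a_i)}{\mathrm{kl}(\mu(a_i),\mu(a_1))}.$$ -/

import Mathlib

open MeasureTheory ProbabilityTheory Filter
open scoped ENNReal unitInterval

/-- A multi-armed bandit with abandonment: `μ a` is the mean of the Bernoulli reward of arm `a`, and
`q s r` is the probability that the user abandons when the current state is `s` and the reward just
obtained is `r`. States and rewards lie in `{0, 1}`, coded as `Bool` (`false` is 0, `true` is 1). -/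
structure MABA (M : ℕ) where
  μ : Fin M → I
  q : Bool → Bool → I

/-- One observed step: state, arm pulled, reward, and whether the user abandoned after it (this flag
marks the boundaries between episodes in the flat list of samples). -/
structure Sample (M : ℕ) where
  state : Bool
  arm : Fin M
  reward : Bool
  abandoned : Bool

/-- The samples of all the past steps, over all episodes, most recent first. -/
abbrev History (M : ℕ) := List (Sample M)

/-- A deterministic policy: from the current (non-terminal) state and the historical samples to an
arm. -/
abbrev Policy (M : ℕ) := Bool → History M → Fin M

/-- The fresh randomness of one time step: the reward that each arm `a` would give, and, for each
pair (state, reward), whether abandonment would occur. -/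
abbrev Seed (M : ℕ) := (Fin M → Bool) × (Bool × Bool → Bool)

noncomputable section

namespace MABA

variable {M : ℕ}

/-- The Bernoulli distribution of mean `p` on `{0, 1}`. -/
abbrev ber (p : I) : Measure Bool := bernoulliMeasure true false p

/-- Kullback-Leibler divergence between the Bernoulli distributions of parameters `p₁` and `p₂`
(it is `∞` where absolute continuity fails). -/
def kl (p₁ p₂ : I) : ℝ≥0∞ := InformationTheory.klDiv (ber p₁) (ber p₂)

/-! ### The model -/

/-- The law of one seed: all rewards and abandonment flags are independent Bernoulli variables with
the parameters of the model. -/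
def seedLaw (m : MABA M) : Measure (Seed M) :=
  (Measure.pi fun a => ber (m.μ a)).prod (Measure.pi fun sr : Bool × Bool => ber (m.q sr.1 sr.2))

instance (m : MABA M) : IsProbabilityMeasure m.seedLaw := by
  unfold seedLaw; infer_instance

/-- The law of an i.i.d. sequence of seeds. -/
def seedsLaw (m : MABA M) : Measure (ℕ → Seed M) := Measure.infinitePi fun _ => m.seedLaw

instance (m : MABA M) : IsProbabilityMeasure m.seedsLaw := by
  unfold seedsLaw; infer_instance

/-- The situation just before a time step: index of the current episode (counted from 0), current
state, and the samples of the past steps. -/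
structure Config (M : ℕ) where
  episode : ℕ
  state : Bool
  hist : History M

/-- One time step under `π`. If the user abandons, the next episode begins, and its initial state
is read off the sequence `z`; otherwise the reward is the next state. -/
def step (π : Policy M) (z : ℕ → Bool) (x : Seed M) (C : Config M) : Config M :=
  let a := π C.state C.hist
  let r := x.1 a
  let d := x.2 (C.state, r)
  { episode := if d then C.episode + 1 else C.episode
    state := if d then z (C.episode + 1) else r
    hist := ⟨C.state, a, r, d⟩ :: C.hist }

/-- The process under `π`: `run π z x t` is the situation after `t` time steps, where `x t` is the
seed of the (`t+1`)-st step and `z k` is the initial state of the `k`-th episode (`k ≥ 0`). -/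
def run (π : Policy M) (z : ℕ → Bool) (x : ℕ → Seed M) : ℕ → Config M
  | 0 => ⟨0, z 0, []⟩
  | t + 1 => step π z (x t) (run π z x t)

/-- The reward obtained at a time step whose preceding situation is `C` and whose seed is `x`. -/
def rewardAt (π : Policy M) (x : Seed M) (C : Config M) : ℝ≥0∞ :=
  if x.1 (π C.state C.hist) then 1 else 0

/-- The total reward collected by `π` during the first `K` episodes. -/
def totalReward (π : Policy M) (K : ℕ) (z : ℕ → Bool) (x : ℕ → Seed M) : ℝ≥0∞ :=
  ∑' t, if (run π z x t).episode < K then rewardAt π (x t) (run π z x t) else 0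

/-- The expected total reward of `π` during the first `K` episodes, where `ν` is the law of the
sequence of initial states, which is independent of the seeds. -/
def expReward (m : MABA M) (ν : Measure (ℕ → Bool)) (π : Policy M) (K : ℕ) : ℝ≥0∞ :=
  ∫⁻ ω, totalReward π K ω.2 ω.1 ∂(m.seedsLaw.prod ν)

/-- The expected regret over `K` episodes of `π` against always pulling arm `b`. -/
def regret (m : MABA M) (ν : Measure (ℕ → Bool)) (b : Fin M) (π : Policy M) (K : ℕ) : ℝ :=
  (m.expReward ν (fun _ _ => b) K).toReal - (m.expReward ν π K).toReal

/-! ### Value function and Q-function -/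

/-- The states visited in a single episode which starts in state `s` and in which arm `act h` is
pulled at the (`h+1`)-st step; `none` is the terminal state. -/
def path (act : ℕ → Fin M) (s : Bool) (x : ℕ → Seed M) : ℕ → Option Bool
  | 0 => some s
  | h + 1 =>
    match path act s x h with
    | none => none
    | some s' =>
      let r := (x h).1 (act h)
      if (x h).2 (s', r) then none else some r

/-- The reward collected at the (`h+1`)-st step of that episode (none after abandonment). -/
def pathReward (act : ℕ → Fin M) (s : Bool) (x : ℕ → Seed M) (h : ℕ) : ℝ≥0∞ :=
  if (path act s x h).isSome ∧ (x h).1 (act h) = true then 1 else 0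

/-- `V*(s)`: expected reward of an episode that starts in state `s` when the arm `b` is always
pulled. -/
def V (m : MABA M) (b : Fin M) (s : Bool) : ℝ :=
  (∫⁻ x, ∑' h, pathReward (fun _ => b) s x h ∂m.seedsLaw).toReal

/-- `Q*(s, a)`: the same when arm `a` is pulled at the first step and arm `b` at all later ones. -/
def Q (m : MABA M) (b : Fin M) (s : Bool) (a : Fin M) : ℝ :=
  m.μ a +
    (∫⁻ x, ∑' h, pathReward (fun n => if n = 0 then a else b) s x (h + 1) ∂m.seedsLaw).toReal

/-! ### The algorithm -/

/-- `N_t(a)`: how often arm `a` has been pulled. -/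
def pulls (φ : History M) (a : Fin M) : ℕ := φ.countP fun y => y.arm = a

/-- The sum of the rewards obtained from arm `a`. -/
def rewardSum (φ : History M) (a : Fin M) : ℕ := φ.countP fun y => y.arm = a ∧ y.reward = true

lemma rewardSum_le_pulls (φ : History M) (a : Fin M) : rewardSum φ a ≤ pulls φ a := by
  unfold rewardSum pulls
  apply List.countP_mono_left
  intro y _ h
  simp only [decide_eq_true_eq] at h ⊢
  exact h.1

/-- The empirical mean of the rewards of arm `a` (0 if it has not been pulled). -/
def empMean (φ : History M) (a : Fin M) : I :=
  ⟨(rewardSum φ a : ℝ) / (pulls φ a : ℝ), by positivity,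
    div_le_one_of_le₀ (by exact_mod_cast rewardSum_le_pulls φ a) (by positivity)⟩

/-- The parameters `p ∈ [0, 1]` with `kl(μ̄_t(a), p) N_t(a) ≤ c' log t + c log (log t)`, where
`t = |φ| + 1` is the current time step, counted from 1. -/
def confSet (c' c : ℝ) (φ : History M) (a : Fin M) : Set I :=
  {p | kl (empMean φ a) p * (pulls φ a : ℝ≥0∞) ≤
    ENNReal.ofReal (c' * Real.log ((φ.length : ℝ) + 1) +
      c * Real.log (Real.log ((φ.length : ℝ) + 1)))}

/-- The KL index of arm `a`: the lower end of the confidence set in state 0, the upper end in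
state 1. -/
def klIndex (c₀ c₁ c : ℝ) (s : Bool) (φ : History M) (a : Fin M) : ℝ :=
  if s then sSup (((↑) : I → ℝ) '' confSet c₁ c φ a)
  else sInf (((↑) : I → ℝ) '' confSet c₀ c φ a)

/-- `π` is a KL-ULCB policy: as long as some arm has not been pulled, it pulls such an arm; after
that it pulls an arm of maximal index (ties broken in any way). -/
def IsKLULCB (c₀ c₁ c : ℝ) (π : Policy M) : Prop :=
  ∀ (s : Bool) (φ : History M),
    ((∃ a, pulls φ a = 0) → pulls φ (π s φ) = 0) ∧
    ((∀ a, pulls φ a ≠ 0) → ∀ a, klIndex c₀ c₁ c s φ a ≤ klIndex c₀ c₁ c s φ (π s φ))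

end MABA

end

/-! ### Bernoulli integrals and the Bernoulli divergence -/

namespace MABA

/-! Write b for the best arm. The sequence of initial states is fixed; every bound below is uniform
in it and is integrated only at the end. The expectations `ev` then obey a one-step recursion
(`ev_succ`), so most estimates reduce to a one-step drift inequality for a function of the
configuration.

Regret. The value function of always pulling b solves a Bellman equation and is finite, and b is
greedy for it (`VE_eq_bellman`, `VE_ne_top`, `bellman_le_VE`). Telescoping this value along the
process turns the regret into the expected sum of the gaps of the arms pulled
(`tsum_ev_reward_add_gap`, `regret_le`). It remains to count suboptimal pulls, separately in the two
states.

Deviations. The likelihood ratio of the samples of one arm is a martingale, and at the empirical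
mean it equals exp(n kl(empirical mean, true mean)) after n pulls. Summing over the n + 1 possible
empirical means costs a factor n + 1. This is paid for by the Pythagorean inequality
`klReal_pythagoras`: a deviation beyond a threshold w strictly past the true mean leaves an extra
exp(-n kl(w, true mean)) to spend.

State 1. Take thresholds μ(a) < w(a) < y < x < μ(b). If a suboptimal arm a is pulled, then the upper
index of b is below x, or the empirical mean of a is at least w(a), or a has been pulled at most
about log T / kl(w(a), y) times (`armAt_of_state_true`). The first event has probability O(1 / (t
(log t)^4)) at step t. The second is summable along the pulls of a. Only the third contributes a
logarithm.

State 0. The lower index favours arms that have been sampled often. If a is pulled, its lower index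
is too large, or b has deviated after many pulls, or b has few pulls (`armAt_of_state_false`). State
1 is visited linearly often outside exponentially unlikely events, and there almost all pulls go to
b. So b has more than logarithmically many pulls except for boundedly many steps in expectation
(`exists_sum_ev_pulls_le`), and state 0 contributes O(1).

Conclusion. K episodes end within a multiple of K + 1 steps up to a geometric tail
(`exists_ev_live_le`), so log T is asymptotic to log K. Letting w(a) tend to μ(a) and y to μ(b)
gives the stated constant. -/

lemma lintegral_ber (p : I) (f : Bool → ℝ≥0∞) :
    ∫⁻ b, f b ∂(ber p) = ENNReal.ofReal p * f true + ENNReal.ofReal (1 - p) * f false := by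
  have h1 : ((unitInterval.toNNReal p : NNReal) : ℝ≥0∞) = ENNReal.ofReal p := by
    rw [ENNReal.ofReal, ENNReal.coe_inj]
    ext
    simp [p.2.1]
  have h2 : ((unitInterval.toNNReal (unitInterval.symm p) : NNReal) : ℝ≥0∞)
      = ENNReal.ofReal (1 - p) := by
    rw [ENNReal.ofReal, ENNReal.coe_inj]
    ext
    simp [p.2.2]
  rw [ber, bernoulliMeasure_def, lintegral_add_measure]
  simp only [lintegral_smul_measure, lintegral_dirac, ENNReal.smul_def, smul_eq_mul, h1, h2]

lemma ber_singleton (p : I) (b : Bool) :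
    ber p {b} = if b then ENNReal.ofReal p else ENNReal.ofReal (1 - p) := by
  have := lintegral_ber p (Set.indicator {b} 1)
  rw [lintegral_indicator_one (by measurability)] at this
  rw [this]
  cases b <;> simp

/-- The Kullback-Leibler divergence between Bernoulli distributions, as a real function. -/
noncomputable def klReal (x y : ℝ) : ℝ :=
  x * Real.log (x / y) + (1 - x) * Real.log ((1 - x) / (1 - y))

lemma klReal_nonneg {x y : ℝ} (hx : x ∈ Set.Icc (0 : ℝ) 1) (hy : y ∈ Set.Ioo (0 : ℝ) 1) :
    0 ≤ klReal x y := by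
  have h1 := InformationTheory.klFun_nonneg (div_nonneg hx.1 hy.1.le)
  have h2 := InformationTheory.klFun_nonneg
    (div_nonneg (sub_nonneg.2 hx.2) (sub_nonneg.2 hy.2.le))
  have hy0 := hy.1
  have hy1 : 0 < 1 - y := sub_pos.2 hy.2
  have e : klReal x y = y * InformationTheory.klFun (x / y)
      + (1 - y) * InformationTheory.klFun ((1 - x) / (1 - y)) := by
    unfold klReal InformationTheory.klFun
    field_simp
    ring
  rw [e]
  positivity

/-- Both atoms have positive mass under `ber y`, so the density is the ratio of the masses of the
atoms. -/
lemma kl_eq_ofReal (x y : I) (hy : (y : ℝ) ∈ Set.Ioo (0 : ℝ) 1) :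
    kl x y = ENNReal.ofReal (klReal x y) := by
  have hy0 := hy.1
  have hy1 : (0 : ℝ) < 1 - y := sub_pos.2 hy.2
  have hpos : ∀ b : Bool, ber y {b} ≠ 0 := by
    intro b
    rw [ber_singleton]
    cases b <;> simp [hy0, hy.2]
  have hfin : ∀ b : Bool, ber y {b} ≠ ∞ := fun b => measure_ne_top _ _
  have hac : ber x ≪ ber y := by
    intro s hs
    have : s = ∅ := by
      by_contra h
      obtain ⟨b, hb⟩ := Set.nonempty_iff_ne_empty.2 h
      exact hpos b (measure_mono_null (Set.singleton_subset_iff.2 hb) hs)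
    simp [this]
  have hrn : ∀ b : Bool, ((ber x).rnDeriv (ber y) b).toReal
      = (ber x {b}).toReal / (ber y {b}).toReal := by
    intro b
    have := Measure.setLIntegral_rnDeriv hac {b}
    rw [lintegral_singleton] at this
    rw [← this, ENNReal.toReal_mul, mul_div_assoc, div_self, mul_one]
    exact (ENNReal.toReal_pos (hpos b) (hfin b)).ne'
  unfold kl
  rw [InformationTheory.klDiv_eq_lintegral_klFun_of_ac hac, lintegral_ber, hrn, hrn]
  simp only [ber_singleton, if_true, Bool.false_eq_true, if_false]
  rw [ENNReal.toReal_ofReal x.2.1, ENNReal.toReal_ofReal y.2.1,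
    ENNReal.toReal_ofReal (sub_nonneg.2 x.2.2), ENNReal.toReal_ofReal hy1.le,
    ← ENNReal.ofReal_mul hy0.le, ← ENNReal.ofReal_mul hy1.le, ← ENNReal.ofReal_add]
  · congr 1
    unfold klReal InformationTheory.klFun
    field_simp
    ring
  · exact mul_nonneg hy0.le
      (InformationTheory.klFun_nonneg (div_nonneg x.2.1 hy0.le))
  · exact mul_nonneg hy1.le
      (InformationTheory.klFun_nonneg (div_nonneg (sub_nonneg.2 x.2.2) hy1.le))

lemma kl_eq_top (x y : I) (hy : (y : ℝ) = 0 ∨ (y : ℝ) = 1) (hxy : (x : ℝ) ≠ y) :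
    kl x y = ∞ := by
  apply InformationTheory.klDiv_of_not_ac
  intro hac
  have hx := x.2
  rcases hy with hy | hy
  · have : ber y {true} = 0 := by rw [ber_singleton]; simp [hy]
    have := hac this
    simp only [ber_singleton, if_true, ENNReal.ofReal_eq_zero] at this
    exact hxy (by rw [hy]; exact le_antisymm this hx.1)
  · have : ber y {false} = 0 := by rw [ber_singleton]; simp [hy]
    have := hac this
    simp only [ber_singleton, Bool.false_eq_true, if_false, ENNReal.ofReal_eq_zero] at this
    exact hxy (by rw [hy]; exact le_antisymm hx.2 (by linarith))

/-- `w` lies between `x` and `y`. -/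
def Between (x w y : ℝ) : Prop := (x ≤ w ∧ w ≤ y) ∨ (y ≤ w ∧ w ≤ x)

/-- The difference of the two sides is (x - w)(logit w - logit y), and betweenness gives the two
factors the same sign. It yields both monotonicity of the divergence and the exponential surplus in
the deviation bounds. -/
lemma klReal_pythagoras {x w y : ℝ} (hx : x ∈ Set.Icc (0 : ℝ) 1) (hw : w ∈ Set.Ioo (0 : ℝ) 1)
    (hy : y ∈ Set.Ioo (0 : ℝ) 1) (h : Between x w y) :
    klReal x w + klReal w y ≤ klReal x y := by
  have hw0 := hw.1
  have hw1 : 0 < 1 - w := sub_pos.2 hw.2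
  have hy0 := hy.1
  have hy1 : 0 < 1 - y := sub_pos.2 hy.2
  have l1 : ∀ u v : ℝ, 0 < v → 0 ≤ u →
      u * Real.log (u / v) = u * Real.log u - u * Real.log v := by
    intro u v hv hu
    rcases hu.eq_or_lt with rfl | hu
    · simp
    · rw [Real.log_div hu.ne' hv.ne']; ring
  unfold klReal
  rw [l1 x w hw0 hx.1, l1 x y hy0 hx.1, l1 w y hy0 hw0.le, l1 _ _ hw1 (sub_nonneg.2 hx.2),
    l1 _ _ hy1 (sub_nonneg.2 hx.2), l1 _ _ hy1 hw1.le]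
  have key : 0 ≤ (x - w) * ((Real.log w - Real.log y)
      + (Real.log (1 - y) - Real.log (1 - w))) := by
    rcases h with ⟨h1, h2⟩ | ⟨h1, h2⟩
    · apply mul_nonneg_of_nonpos_of_nonpos (by linarith)
      have := Real.log_le_log hw0 h2
      have := Real.log_le_log hy1 (by linarith : 1 - y ≤ 1 - w)
      linarith
    · apply mul_nonneg (by linarith)
      have := Real.log_le_log hy0 h1
      have := Real.log_le_log hw1 (by linarith : 1 - w ≤ 1 - y)
      linarith
  nlinarith [key]

lemma klReal_pos {x y : ℝ} (hx : x ∈ Set.Ioo (0 : ℝ) 1) (hy : y ∈ Set.Ioo (0 : ℝ) 1)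
    (h : x ≠ y) : 0 < klReal x y := by
  have h0 : kl ⟨x, hx.1.le, hx.2.le⟩ ⟨y, hy.1.le, hy.2.le⟩ ≠ 0 := by
    intro h0
    have := InformationTheory.klDiv_eq_zero_iff.1 h0
    have h1 := congrArg (fun ν : Measure Bool => (ν {true}).toReal) this
    simp only [ber_singleton, if_true] at h1
    rw [ENNReal.toReal_ofReal hx.1.le, ENNReal.toReal_ofReal hy.1.le] at h1
    exact h h1
  rw [kl_eq_ofReal _ _ hy] at h0
  simpa using h0

/-- For interior p this is `klReal_pythagoras` with one nonnegative term dropped; at an endpoint p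
the right side is infinite. -/
lemma kl_mono_right {x y p : I} (hy : (y : ℝ) ∈ Set.Ioo (0 : ℝ) 1) (h : Between x y p) :
    kl x y ≤ kl x p := by
  by_cases hp : (p : ℝ) ∈ Set.Ioo (0 : ℝ) 1
  · rw [kl_eq_ofReal _ _ hy, kl_eq_ofReal _ _ hp]
    apply ENNReal.ofReal_le_ofReal
    have := klReal_pythagoras x.2 hy hp h
    have := klReal_nonneg ⟨hy.1.le, hy.2.le⟩ hp
    linarith
  · rw [kl_eq_top x p]
    · exact le_top
    · have := p.2
      by_contra hc
      push Not at hc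
      exact hp ⟨lt_of_le_of_ne this.1 (Ne.symm hc.1), lt_of_le_of_ne this.2 hc.2⟩
    · intro e
      rcases h with h | h
      · exact hp (e ▸ (le_antisymm h.1 (e ▸ h.2)) ▸ hy)
      · exact hp (e ▸ (le_antisymm h.2 (e ▸ h.1)) ▸ hy)

lemma continuousAt_klReal {x y : ℝ} (hx : x ∈ Set.Ioo (0 : ℝ) 1) (hy : y ∈ Set.Ioo (0 : ℝ) 1) :
    ContinuousAt (fun p : ℝ × ℝ => klReal p.1 p.2) (x, y) := by
  have hx0 := hx.1
  have hx1 : 0 < 1 - x := sub_pos.2 hx.2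
  have hy0 := hy.1
  have hy1 : 0 < 1 - y := sub_pos.2 hy.2
  unfold klReal
  refine ContinuousAt.add (ContinuousAt.mul continuousAt_fst (ContinuousAt.log ?_ ?_))
    (ContinuousAt.mul (by fun_prop) (ContinuousAt.log ?_ ?_))
  · exact ContinuousAt.div (by fun_prop) (by fun_prop) hy0.ne'
  · exact (div_pos hx0 hy0).ne'
  · exact ContinuousAt.div (by fun_prop) (by fun_prop) hy1.ne'
  · exact (div_pos hx1 hy1).ne'

end MABA

namespace MABA

variable {M : ℕ}

/-! ### Expectations along the process -/

/-- What is determined by the first t seeds is independent of the next one, which can therefore be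
integrated out first. This is the Markov property behind every one-step recursion below. -/
lemma lintegral_indep_coord (m : MABA M) {α : Type*} [MeasurableSpace α] [Countable α]
    [DiscreteMeasurableSpace α] (t : ℕ) (X : (ℕ → Seed M) → α)
    (hdep : ∀ x y, (∀ i < t, x i = y i) → X x = X y) (F : α → Seed M → ℝ≥0∞) :
    Measurable X ∧
    ∫⁻ x, F (X x) (x t) ∂m.seedsLaw = ∫⁻ x, ∫⁻ s, F (X x) s ∂m.seedLaw ∂m.seedsLaw := by
  classical
  set Y : (ℕ → Seed M) → (Finset.range t → Seed M) := fun x i => x i with hY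
  -- X factors through finitely many coordinates; the default seeds fed to the others are harmless
  -- by `hdep`.
  set G : (Finset.range t → Seed M) → α := fun y =>
    X fun i => if h : i ∈ Finset.range t then y ⟨i, h⟩ else default with hG
  have hXG : X = G ∘ Y := by
    funext x
    apply hdep
    intro i hi
    simp [hY, Finset.mem_range.2 hi]
  have hYm : Measurable Y := by fun_prop
  have hGm : Measurable G := Measurable.of_discrete
  have hXm : Measurable X := hXG ▸ hGm.comp hYm
  refine ⟨hXm, ?_⟩
  have hind : iIndepFun (fun (i : ℕ) (x : ℕ → Seed M) => x i) m.seedsLaw :=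
    iIndepFun_infinitePi (P := fun _ : ℕ => m.seedLaw) (X := fun _ s => s) (fun _ => measurable_id)
  have h1 := hind.indepFun_finset (Finset.range t) {t} (by simp) (fun i => by fun_prop)
  have h2 : IndepFun X (fun x => x t) m.seedsLaw := by
    have := h1.comp hGm
      (measurable_pi_apply (⟨t, Finset.mem_singleton_self t⟩ : ({t} : Finset ℕ)))
    rw [hXG]
    exact this
  have ht : Measurable fun x : ℕ → Seed M => x t := by fun_prop
  have h3 := (indepFun_iff_map_prod_eq_prod_map_map hXm.aemeasurable ht.aemeasurable).1 h2
  have h4 : m.seedsLaw.map (fun x => x t) = m.seedLaw :=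
    Measure.infinitePi_map_eval (μ := fun _ : ℕ => m.seedLaw) t
  rw [h4] at h3
  have hF : Measurable fun p : α × Seed M => F p.1 p.2 := Measurable.of_discrete
  calc ∫⁻ x, F (X x) (x t) ∂m.seedsLaw
      = ∫⁻ p, F p.1 p.2 ∂(m.seedsLaw.map fun x => (X x, x t)) :=
        (lintegral_map hF (hXm.prodMk ht)).symm
    _ = ∫⁻ c, ∫⁻ s, F c s ∂m.seedLaw ∂(m.seedsLaw.map X) := by
        have : IsProbabilityMeasure (m.seedsLaw.map X) :=
          Measure.isProbabilityMeasure_map hXm.aemeasurable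
        rw [h3, lintegral_prod _ hF.aemeasurable]
    _ = _ := lintegral_map Measurable.of_discrete hXm

/-- Averaging a function of the reward of arm `a` and of the abandonment flag read off at that
reward. -/
noncomputable def avg (m : MABA M) (s : Bool) (a : Fin M) (g : Bool → Bool → ℝ≥0∞) : ℝ≥0∞ :=
  ENNReal.ofReal (m.μ a) * (ENNReal.ofReal (m.q s true) * g true true
      + ENNReal.ofReal (1 - m.q s true) * g true false)
    + ENNReal.ofReal (1 - m.μ a) * (ENNReal.ofReal (m.q s false) * g false true
      + ENNReal.ofReal (1 - m.q s false) * g false false)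

lemma lintegral_seedLaw (m : MABA M) (s : Bool) (a : Fin M) (g : Bool → Bool → ℝ≥0∞) :
    ∫⁻ x, g (x.1 a) (x.2 (s, x.1 a)) ∂m.seedLaw = m.avg s a g := by
  unfold seedLaw avg
  rw [lintegral_prod _ Measurable.of_discrete.aemeasurable]
  have h1 : ∀ r : Bool, ∫⁻ y : Bool × Bool → Bool, g r (y (s, r))
      ∂(Measure.pi fun sr : Bool × Bool => ber (m.q sr.1 sr.2))
      = ENNReal.ofReal (m.q s r) * g r true + ENNReal.ofReal (1 - m.q s r) * g r false := by
    intro r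
    rw [← lintegral_ber]
    exact (measurePreserving_eval (fun sr : Bool × Bool => ber (m.q sr.1 sr.2)) (s, r)).lintegral_comp
      Measurable.of_discrete
  simp only [h1]
  rw [← lintegral_ber (m.μ a) (fun r => ENNReal.ofReal (m.q s r) * g r true
    + ENNReal.ofReal (1 - m.q s r) * g r false)]
  exact (measurePreserving_eval (fun a => ber (m.μ a)) a).lintegral_comp
    (f := fun r => ENNReal.ofReal (m.q s r) * g r true + ENNReal.ofReal (1 - m.q s r) * g r false)
    Measurable.of_discrete

lemma ofReal_add_ofReal_one_sub (p : I) :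
    ENNReal.ofReal p + ENNReal.ofReal (1 - p) = 1 := by
  rw [← ENNReal.ofReal_add p.2.1 (sub_nonneg.2 p.2.2)]
  simp

lemma avg_const (m : MABA M) (s : Bool) (a : Fin M) (c : ℝ≥0∞) :
    m.avg s a (fun _ _ => c) = c := by
  rw [← lintegral_seedLaw]
  simp

lemma avg_mono (m : MABA M) (s : Bool) (a : Fin M) {g g' : Bool → Bool → ℝ≥0∞}
    (h : ∀ r d, g r d ≤ g' r d) : m.avg s a g ≤ m.avg s a g' := by
  rw [← lintegral_seedLaw, ← lintegral_seedLaw]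
  exact lintegral_mono fun x => h _ _

lemma avg_add (m : MABA M) (s : Bool) (a : Fin M) (g g' : Bool → Bool → ℝ≥0∞) :
    m.avg s a (fun r d => g r d + g' r d) = m.avg s a g + m.avg s a g' := by
  unfold avg; ring

lemma avg_const_mul (m : MABA M) (s : Bool) (a : Fin M) (c : ℝ≥0∞) (g : Bool → Bool → ℝ≥0∞) :
    m.avg s a (fun r d => c * g r d) = c * m.avg s a g := by
  unfold avg; ring

/-- The averages over rewards alone. -/
lemma avg_reward (m : MABA M) (s : Bool) (a : Fin M) (g : Bool → ℝ≥0∞) :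
    m.avg s a (fun r _ => g r)
      = ENNReal.ofReal (m.μ a) * g true + ENNReal.ofReal (1 - m.μ a) * g false := by
  unfold avg
  rw [← add_mul, ← add_mul, ofReal_add_ofReal_one_sub, ofReal_add_ofReal_one_sub, one_mul, one_mul]

/-- Countability together with the discrete σ-algebra makes every function of a configuration, or of
a configuration and a seed, measurable. -/
instance : Countable (Config M) := by
  have h : Function.Injective (fun C : Config M => (C.episode, C.state,
      C.hist.map fun y => (y.state, y.arm, y.reward, y.abandoned))) := by
    rintro ⟨e, s, l⟩ ⟨e', s', l'⟩ h
    simp only [Prod.mk.injEq] at h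
    obtain ⟨rfl, rfl, h⟩ := h
    congr 1
    refine List.map_injective_iff.2 ?_ h
    rintro ⟨⟩ ⟨⟩ h
    simp_all
  exact h.countable

instance : MeasurableSpace (Config M) := ⊤

instance : DiscreteMeasurableSpace (Config M) := ⟨fun _ => trivial⟩

lemma run_congr (π : Policy M) (z : ℕ → Bool) (t : ℕ) {x y : ℕ → Seed M}
    (h : ∀ i < t, x i = y i) : run π z x t = run π z y t := by
  induction t with
  | zero => rfl
  | succ t ih =>
    simp only [run]
    rw [ih fun i hi => h i (by omega), h t (by omega)]

lemma measurable_run (π : Policy M) (z : ℕ → Bool) (t : ℕ) :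
    Measurable fun x : ℕ → Seed M => run π z x t := by
  classical
  have h : (fun x : ℕ → Seed M => run π z x t) = (fun y : Finset.range t → Seed M =>
      run π z (fun i => if h : i ∈ Finset.range t then y ⟨i, h⟩ else default) t)
      ∘ fun x i => x i := by
    funext x
    apply run_congr
    intro i hi
    simp [hi]
  rw [h]
  exact Measurable.of_discrete.comp (by fun_prop)

/-- The configuration after a step in which arm `a` yields the reward `r` and `d` tells whether the
user abandons. -/
def after (z : ℕ → Bool) (C : Config M) (a : Fin M) (r d : Bool) : Config M :=
  { episode := if d then C.episode + 1 else C.episode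
    state := if d then z (C.episode + 1) else r
    hist := ⟨C.state, a, r, d⟩ :: C.hist }

/-- The arm that `π` pulls in the configuration `C`. -/
def armAt (π : Policy M) (C : Config M) : Fin M := π C.state C.hist

/-- The conditional expectation of `f` after one more step. -/
noncomputable def next (m : MABA M) (π : Policy M) (z : ℕ → Bool) (f : Config M → ℝ≥0∞)
    (C : Config M) : ℝ≥0∞ :=
  m.avg C.state (armAt π C) fun r d => f (after z C (armAt π C) r d)

/-- The expectation of `f` after `t` steps. -/
noncomputable def ev (m : MABA M) (π : Policy M) (z : ℕ → Bool) (t : ℕ)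
    (f : Config M → ℝ≥0∞) : ℝ≥0∞ :=
  ∫⁻ x, f (run π z x t) ∂m.seedsLaw

section ev

variable (m : MABA M) (π : Policy M) (z : ℕ → Bool)

lemma ev_zero (f : Config M → ℝ≥0∞) : ev m π z 0 f = f ⟨0, z 0, []⟩ := by
  simp [ev, run]

lemma ev_succ (t : ℕ) (f : Config M → ℝ≥0∞) :
    ev m π z (t + 1) f = ev m π z t (next m π z f) := by
  have h := (lintegral_indep_coord m t (fun x => run π z x t)
    (fun x y h => run_congr π z t h) (fun C s => f (step π z s C))).2
  refine h.trans (lintegral_congr fun x => ?_)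
  rw [next, ← lintegral_seedLaw]
  rfl

lemma ev_reward (t : ℕ) (f : Config M → ℝ≥0∞) :
    ∫⁻ x, f (run π z x t) * rewardAt π (x t) (run π z x t) ∂m.seedsLaw
      = ev m π z t fun C => f C * ENNReal.ofReal (m.μ (armAt π C)) := by
  have h := (lintegral_indep_coord m t (fun x => run π z x t)
    (fun x y h => run_congr π z t h) (fun C s => f C * rewardAt π s C)).2
  refine h.trans (lintegral_congr fun x => ?_)
  rw [lintegral_const_mul _ Measurable.of_discrete]
  congr 1
  have h := lintegral_seedLaw m (run π z x t).state (armAt π (run π z x t))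
    (fun r _ => if r then 1 else 0)
  rw [avg_reward] at h
  refine Eq.trans ?_ (h.trans (by simp))
  rfl

variable {m π z}

lemma ev_mono {t : ℕ} {f g : Config M → ℝ≥0∞} (h : ∀ C, f C ≤ g C) :
    ev m π z t f ≤ ev m π z t g := lintegral_mono fun _ => h _

lemma ev_add (t : ℕ) (f g : Config M → ℝ≥0∞) :
    ev m π z t (fun C => f C + g C) = ev m π z t f + ev m π z t g :=
  lintegral_add_left (Measurable.of_discrete.comp (measurable_run π z t)) _

lemma ev_const_mul (t : ℕ) (c : ℝ≥0∞) (f : Config M → ℝ≥0∞) :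
    ev m π z t (fun C => c * f C) = c * ev m π z t f :=
  lintegral_const_mul _ (Measurable.of_discrete.comp (measurable_run π z t))

lemma ev_finset_sum {ι : Type*} (t : ℕ) (s : Finset ι) (f : ι → Config M → ℝ≥0∞) :
    ev m π z t (fun C => ∑ i ∈ s, f i C) = ∑ i ∈ s, ev m π z t (f i) :=
  lintegral_finsetSum _ fun _ _ => Measurable.of_discrete.comp (measurable_run π z t)

lemma ev_tsum {ι : Type*} [Countable ι] (t : ℕ) (f : ι → Config M → ℝ≥0∞) :
    ev m π z t (fun C => ∑' i, f i C) = ∑' i, ev m π z t (f i) :=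
  lintegral_tsum fun _ => (Measurable.of_discrete.comp (measurable_run π z t)).aemeasurable

lemma ev_const (t : ℕ) (c : ℝ≥0∞) : ev m π z t (fun _ => c) = c := by
  simp [ev]

lemma run_hist_length (x : ℕ → Seed M) (t : ℕ) : (run π z x t).hist.length = t := by
  induction t with
  | zero => rfl
  | succ t ih => simp [run, step, ih]

/-- Expectations only see configurations whose history has the right length. -/
lemma ev_mono_length {t : ℕ} {f g : Config M → ℝ≥0∞} (h : ∀ C, C.hist.length = t → f C ≤ g C) :
    ev m π z t f ≤ ev m π z t g := lintegral_mono fun _ => h _ (run_hist_length _ _)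

/-- A nonnegative supermartingale with running cost `c`. -/
lemma sum_ev_add_ev_le {c Ψ : Config M → ℝ≥0∞} (h : ∀ C, c C + next m π z Ψ C ≤ Ψ C) (T : ℕ) :
    (∑ t ∈ Finset.range T, ev m π z t c) + ev m π z T Ψ ≤ Ψ ⟨0, z 0, []⟩ := by
  induction T with
  | zero => simp [ev_zero]
  | succ T ih =>
    rw [Finset.sum_range_succ, ev_succ, add_assoc, ← ev_add]
    exact (add_le_add le_rfl (ev_mono h)).trans ih

lemma sum_ev_add_ev_eq {c Ψ : Config M → ℝ≥0∞} (h : ∀ C, c C + next m π z Ψ C = Ψ C) (T : ℕ) :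
    (∑ t ∈ Finset.range T, ev m π z t c) + ev m π z T Ψ = Ψ ⟨0, z 0, []⟩ := by
  induction T with
  | zero => simp [ev_zero]
  | succ T ih =>
    rw [Finset.sum_range_succ, ev_succ, add_assoc, ← ev_add]
    simp only [h]
    exact ih

lemma ev_le_geometric {κ : ℝ≥0∞} {Ψ : Config M → ℝ≥0∞} (h : ∀ C, next m π z Ψ C ≤ κ * Ψ C)
    (t : ℕ) : ev m π z t Ψ ≤ κ ^ t * Ψ ⟨0, z 0, []⟩ := by
  induction t with
  | zero => simp [ev_zero]
  | succ t ih =>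
    rw [ev_succ]
    calc _ ≤ ev m π z t (fun C => κ * Ψ C) := ev_mono h
      _ = κ * ev m π z t Ψ := ev_const_mul _ _ _
      _ ≤ κ * (κ ^ t * Ψ ⟨0, z 0, []⟩) := by gcongr
      _ = _ := by ring

end ev

end MABA

namespace MABA

variable {M : ℕ}

/-! ### Bellman equations -/

lemma avg_ofReal (m : MABA M) (s : Bool) (a : Fin M) (g : Bool → Bool → ℝ)
    (hg : ∀ r d, 0 ≤ g r d) :
    m.avg s a (fun r d => ENNReal.ofReal (g r d)) = ENNReal.ofReal
      (m.μ a * (m.q s true * g true true + (1 - m.q s true) * g true false)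
        + (1 - m.μ a) * (m.q s false * g false true + (1 - m.q s false) * g false false)) := by
  have h1 := m.q s true |>.2
  have h2 := m.q s false |>.2
  have h3 := m.μ a |>.2
  have e1 := sub_nonneg.2 h1.2
  have e2 := sub_nonneg.2 h2.2
  have e3 := sub_nonneg.2 h3.2
  have g1 := hg true true
  have g2 := hg true false
  have g3 := hg false true
  have g4 := hg false false
  unfold avg
  have k1 := mul_nonneg h1.1 g1
  have k2 := mul_nonneg e1 g2
  have k3 := mul_nonneg h2.1 g3
  have k4 := mul_nonneg e2 g4
  rw [ENNReal.ofReal_add (mul_nonneg h3.1 (add_nonneg k1 k2))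
    (mul_nonneg e3 (add_nonneg k3 k4)), ENNReal.ofReal_mul h3.1, ENNReal.ofReal_mul e3,
    ENNReal.ofReal_add k1 k2, ENNReal.ofReal_add k3 k4, ENNReal.ofReal_mul h1.1,
    ENNReal.ofReal_mul e1, ENNReal.ofReal_mul h2.1, ENNReal.ofReal_mul e2]

/-- The one-step operator: expected reward of a step in state `s` with arm `a`, plus the value `v`
of the next state unless the user abandons. -/
noncomputable def bellman (m : MABA M) (v : Bool → ℝ≥0∞) (s : Bool) (a : Fin M) : ℝ≥0∞ :=
  m.avg s a fun r d => (if r then 1 else 0) + if d then 0 else v r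

lemma bellman_eq (m : MABA M) (v : Bool → ℝ≥0∞) (s : Bool) (a : Fin M) :
    m.bellman v s a = ENNReal.ofReal (m.μ a) * (1 + ENNReal.ofReal (1 - m.q s true) * v true)
      + ENNReal.ofReal (1 - m.μ a) * (ENNReal.ofReal (1 - m.q s false) * v false) := by
  have h := ofReal_add_ofReal_one_sub (m.q s true)
  unfold bellman avg
  simp only [if_true, Bool.false_eq_true, if_false, add_zero, zero_add, mul_zero]
  have e : ENNReal.ofReal (m.q s true) * 1 + ENNReal.ofReal (1 - m.q s true) * (1 + v true)
      = 1 + ENNReal.ofReal (1 - m.q s true) * v true := by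
    rw [mul_add, mul_one, mul_one, ← add_assoc, h]
  rw [e]

lemma bellman_ofReal (m : MABA M) (v : Bool → ℝ) (hv : ∀ s, 0 ≤ v s) (s : Bool) (a : Fin M) :
    m.bellman (fun s => ENNReal.ofReal (v s)) s a = ENNReal.ofReal
      (m.μ a * (1 + (1 - m.q s true) * v true) + (1 - m.μ a) * ((1 - m.q s false) * v false)) := by
  have h := avg_ofReal m s a (fun r d => (if r then 1 else 0) + if d then 0 else v r) (by
    intro r d
    have := hv r
    split_ifs <;> simp <;> linarith)
  have e : m.bellman (fun s => ENNReal.ofReal (v s)) s a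
      = m.avg s a fun r d => ENNReal.ofReal ((if r then 1 else 0) + if d then 0 else v r) := by
    unfold bellman
    congr 1
    funext r d
    rw [ENNReal.ofReal_add]
    · congr 1 <;> split_ifs <;> simp
    · split_ifs <;> simp
    · have := hv r
      split_ifs <;> simp [this]
  rw [e, h]
  congr 1
  simp only [if_true, Bool.false_eq_true, if_false]
  ring

lemma bellman_mono (m : MABA M) {v w : Bool → ℝ≥0∞} (h : ∀ s, v s ≤ w s) (s : Bool) (a : Fin M) :
    m.bellman v s a ≤ m.bellman w s a := by
  refine avg_mono m s a fun r d => add_le_add le_rfl ?_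
  split_ifs
  · exact le_rfl
  · exact h r

lemma bellman_tendsto (m : MABA M) {v : ℕ → Bool → ℝ≥0∞} {w : Bool → ℝ≥0∞}
    (h : ∀ s, Tendsto (fun n => v n s) atTop (nhds (w s))) (s : Bool) (a : Fin M) :
    Tendsto (fun n => m.bellman (v n) s a) atTop (nhds (m.bellman w s a)) := by
  simp only [bellman_eq]
  refine Tendsto.add (ENNReal.Tendsto.const_mul (tendsto_const_nhds.add
    (ENNReal.Tendsto.const_mul (h true) (Or.inr ENNReal.ofReal_ne_top)))
    (Or.inr ENNReal.ofReal_ne_top)) (ENNReal.Tendsto.const_mul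
    (ENNReal.Tendsto.const_mul (h false) (Or.inr ENNReal.ofReal_ne_top))
    (Or.inr ENNReal.ofReal_ne_top))

/-- The value of always pulling `b` over a horizon of `n` steps in one episode. -/
noncomputable def horizonValue (m : MABA M) (b : Fin M) : ℕ → Bool → ℝ≥0∞
  | 0 => fun _ => 0
  | n + 1 => fun s => m.bellman (horizonValue m b n) s b

lemma path_congr (act : ℕ → Fin M) (s : Bool) (t : ℕ) {x y : ℕ → Seed M}
    (h : ∀ i < t, x i = y i) : path act s x t = path act s y t := by
  induction t with
  | zero => rfl
  | succ t ih =>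
    simp only [path]
    rw [ih fun i hi => h i (by omega), h t (by omega)]

/-- The extension of a function of the state by `0` at the terminal state. -/
def optVal (v : Bool → ℝ≥0∞) : Option Bool → ℝ≥0∞
  | none => 0
  | some s => v s

lemma measurable_pathReward (m : MABA M) (act : ℕ → Fin M) (s : Bool) (h : ℕ) :
    Measurable fun x => pathReward act s x h := by
  let _ : MeasurableSpace (Option Bool) := ⊤
  have h1 := (lintegral_indep_coord m h (fun x => path act s x h)
    (fun x y hxy => path_congr act s h hxy) (fun _ _ => 0)).1
  have h2 : Measurable fun x : ℕ → Seed M => x h := by fun_prop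
  exact (Measurable.of_discrete (f := fun p : Option Bool × Seed M =>
    if p.1.isSome ∧ p.2.1 (act h) = true then (1 : ℝ≥0∞) else 0)).comp (h1.prodMk h2)

lemma lintegral_pathReward_add (m : MABA M) (act : ℕ → Fin M) (s : Bool) (h : ℕ)
    (v : Bool → ℝ≥0∞) :
    ∫⁻ x, pathReward act s x h ∂m.seedsLaw + ∫⁻ x, optVal v (path act s x (h + 1)) ∂m.seedsLaw
      = ∫⁻ x, optVal (fun s => m.bellman v s (act h)) (path act s x h) ∂m.seedsLaw := by
  let _ : MeasurableSpace (Option Bool) := ⊤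
  rw [← lintegral_add_left (measurable_pathReward m act s h)]
  have h1 := (lintegral_indep_coord m h (fun x => path act s x h)
    (fun x y hxy => path_congr act s h hxy) (fun o y => match o with
      | none => 0
      | some s' => (if y.1 (act h) then 1 else 0)
          + if y.2 (s', y.1 (act h)) then 0 else v (y.1 (act h)))).2
  refine Eq.trans (lintegral_congr fun x => ?_) (h1.trans (lintegral_congr fun x => ?_))
  · rcases hp : path act s x h with _ | s'
    · simp [pathReward, path, hp, optVal]
    · simp only [pathReward, path, hp]
      by_cases hd : (x h).2 (s', (x h).1 (act h)) <;> simp [hd, optVal]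
  · rcases hp : path act s x h with _ | s'
    · simp [optVal]
    · exact lintegral_seedLaw m s' (act h) (fun r d => (if r then 1 else 0) + if d then 0 else v r)

/-- Here U j plays the role of the value to go from step j on; `lintegral_pathReward_add`
telescopes. -/
lemma sum_lintegral_pathReward (m : MABA M) (act : ℕ → Fin M) (s : Bool) (n : ℕ)
    (U : ℕ → Bool → ℝ≥0∞) (hU : ∀ j < n, ∀ s, U j s = m.bellman (U (j + 1)) s (act j)) (j : ℕ)
    (hj : j ≤ n) :
    (∑ h ∈ Finset.range j, ∫⁻ x, pathReward act s x h ∂m.seedsLaw)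
      + ∫⁻ x, optVal (U j) (path act s x j) ∂m.seedsLaw = U 0 s := by
  induction j with
  | zero => simp [path, optVal]
  | succ j ih =>
    rw [Finset.sum_range_succ, add_assoc, lintegral_pathReward_add, ← funext (hU j (by omega))]
    exact ih (by omega)

lemma optVal_zero (o : Option Bool) : optVal (fun _ => 0) o = 0 := by
  cases o <;> rfl

lemma sum_lintegral_pathReward_const (m : MABA M) (b : Fin M) (s : Bool) (n : ℕ) :
    ∑ h ∈ Finset.range n, ∫⁻ x, pathReward (fun _ => b) s x h ∂m.seedsLaw
      = m.horizonValue b n s := by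
  have h := sum_lintegral_pathReward m (fun _ => b) s n (fun j => m.horizonValue b (n - j))
    (by
      intro j hj s
      have : n - j = (n - (j + 1)) + 1 := by omega
      rw [this]
      rfl) n le_rfl
  simpa [horizonValue, optVal_zero] using h

lemma sum_lintegral_pathReward_first (m : MABA M) (a b : Fin M) (s : Bool) (n : ℕ) :
    ∑ h ∈ Finset.range (n + 1),
      ∫⁻ x, pathReward (fun n => if n = 0 then a else b) s x h ∂m.seedsLaw
      = m.bellman (m.horizonValue b n) s a := by
  have h := sum_lintegral_pathReward m (fun n => if n = 0 then a else b) s (n + 1)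
    (fun j => match j with
      | 0 => fun s => m.bellman (m.horizonValue b n) s a
      | j + 1 => m.horizonValue b (n - j))
    (by
      intro j hj s
      cases j with
      | zero => simp
      | succ j =>
        have : n - j = (n - (j + 1)) + 1 := by omega
        simp only [this]
        rfl) (n + 1) le_rfl
  simpa [horizonValue, optVal_zero] using h

/-- The optimal value function as an extended nonnegative number. -/
noncomputable def VE (m : MABA M) (b : Fin M) (s : Bool) : ℝ≥0∞ :=
  ∫⁻ x, ∑' h, pathReward (fun _ => b) s x h ∂m.seedsLaw

lemma tendsto_horizonValue (m : MABA M) (b : Fin M) (s : Bool) :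
    Tendsto (fun n => m.horizonValue b n s) atTop (nhds (m.VE b s)) := by
  simp only [← sum_lintegral_pathReward_const]
  rw [VE, lintegral_tsum fun h => (measurable_pathReward m _ s h).aemeasurable]
  exact ENNReal.tendsto_nat_tsum _

/-- The finite-horizon recursion passes to the limit in [0, ∞], so finiteness is not needed here. -/
lemma VE_eq_bellman (m : MABA M) (b : Fin M) (s : Bool) :
    m.VE b s = m.bellman (m.VE b) s b :=
  tendsto_nhds_unique ((tendsto_add_atTop_iff_nat 1).2 (tendsto_horizonValue m b s))
    (bellman_tendsto m (tendsto_horizonValue m b) s b)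

lemma Q_eq_bellman (m : MABA M) (b : Fin M) (s : Bool) (a : Fin M) (hV : ∀ s, m.VE b s ≠ ∞) :
    m.Q b s a = (m.bellman (m.VE b) s a).toReal ∧ m.bellman (m.VE b) s a ≠ ∞ := by
  have hfin : m.bellman (m.VE b) s a ≠ ∞ := by
    rw [bellman_eq]
    refine ENNReal.add_ne_top.2 ⟨ENNReal.mul_ne_top ENNReal.ofReal_ne_top (ENNReal.add_ne_top.2
      ⟨ENNReal.one_ne_top, ENNReal.mul_ne_top ENNReal.ofReal_ne_top (hV _)⟩),
      ENNReal.mul_ne_top ENNReal.ofReal_ne_top (ENNReal.mul_ne_top ENNReal.ofReal_ne_top (hV _))⟩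
  refine ⟨?_, hfin⟩
  set act : ℕ → Fin M := fun n => if n = 0 then a else b with hact
  have h0 : ∫⁻ x, pathReward act s x 0 ∂m.seedsLaw = ENNReal.ofReal (m.μ a) := by
    have := sum_lintegral_pathReward_first m a b s 0
    rw [Finset.sum_range_one] at this
    rw [this, bellman_eq]
    simp [horizonValue]
  have h1 : m.bellman (m.VE b) s a = ∫⁻ x, pathReward act s x 0 ∂m.seedsLaw
      + ∑' h, ∫⁻ x, pathReward act s x (h + 1) ∂m.seedsLaw := by
    rw [← tsum_eq_zero_add' (f := fun h => ∫⁻ x, pathReward act s x h ∂m.seedsLaw)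
      ENNReal.summable]
    refine tendsto_nhds_unique (bellman_tendsto m (tendsto_horizonValue m b) s a) ?_
    simp only [← sum_lintegral_pathReward_first]
    exact (tendsto_add_atTop_iff_nat 1).2 (ENNReal.tendsto_nat_tsum _)
  rw [h1] at hfin ⊢
  rw [ENNReal.toReal_add (ENNReal.add_ne_top.1 hfin).1 (ENNReal.add_ne_top.1 hfin).2, h0,
    ENNReal.toReal_ofReal (m.μ a).2.1, Q,
    lintegral_tsum fun h => (measurable_pathReward m _ s (h + 1)).aemeasurable]

/-- Two zero rewards in a row have positive probability, and the second then ends the episode with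
positive probability. The proof dominates all finite-horizon values by an explicit supersolution of
the Bellman equation. -/
lemma VE_ne_top (m : MABA M) (b : Fin M) (hμ : m.μ b < 1) (hq : 0 < m.q false false) (s : Bool) :
    m.VE b s ≠ ∞ := by
  have hp : (0 : ℝ) < 1 - m.μ b := sub_pos.2 (show (m.μ b : ℝ) < 1 from hμ)
  have hq' : (0 : ℝ) < m.q false false := hq
  have hp0 := (m.μ b).2.1
  obtain ⟨p, hpdef⟩ : ∃ p : ℝ, p = m.μ b := ⟨_, rfl⟩
  rw [← hpdef] at hp hp0
  set A : ℝ := p / ((1 - p) ^ 2 * m.q false false) with hA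
  set B : ℝ := A + p / (1 - p) with hB
  have hA0 : 0 ≤ A := by positivity
  have hB0 : 0 ≤ B := by positivity
  set g : Bool → ℝ := fun s => if s then B else A with hg
  have hg0 : ∀ s, 0 ≤ g s := by intro s; cases s <;> simp [hg, hA0, hB0]
  have e1 : (1 - p) * (B - A) = p := by rw [hB]; field_simp; ring
  have e2 : (1 - p) * (m.q false false * A) = p * (1 + B - A) := by
    rw [hB, hA]; field_simp; ring
  have hbound : ∀ n s, m.horizonValue b n s ≤ ENNReal.ofReal (g s) := by
    intro n
    induction n with
    | zero => intro s; simp [horizonValue]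
    | succ n ih =>
      intro s
      refine (bellman_mono m ih s b).trans ?_
      rw [bellman_ofReal m g hg0]
      apply ENNReal.ofReal_le_ofReal
      have q1 := (m.q s true).2
      rw [← hpdef]
      have k1 : p * (1 + (1 - m.q s true) * B) ≤ p * (1 + B) := by
        apply mul_le_mul_of_nonneg_left _ hp0
        nlinarith [q1.1]
      cases s with
      | true =>
        have q2 := (m.q true false).2
        have k2 : (1 - p) * ((1 - m.q true false) * A) ≤ (1 - p) * A := by
          apply mul_le_mul_of_nonneg_left _ hp.le
          nlinarith [q2.1]
        simp only [hg, if_true, Bool.false_eq_true, if_false]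
        nlinarith
      | false =>
        simp only [hg, if_true, Bool.false_eq_true, if_false]
        nlinarith
  exact ne_top_of_le_ne_top ENNReal.ofReal_ne_top
    (le_of_tendsto' (tendsto_horizonValue m b s) fun n => hbound n s)

/-- State 1 is worth at least as much as state 0, because survival is likelier there. Hence reward 1
followed by its continuation (X) beats reward 0 followed by its continuation (Y), and the mixture of
X and Y increases with the mean of the arm. -/
lemma bellman_le_VE (m : MABA M) (b : Fin M)
    (hq1 : m.q true true ≤ m.q false true) (hq2 : m.q true false ≤ m.q false false)
    (hq_rew : ∀ s, m.q s true ≤ m.q s false) (s : Bool) (a : Fin M) (ha : m.μ a ≤ m.μ b) :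
    m.bellman (m.VE b) s a ≤ m.VE b s := by
  have hV : m.VE b false ≤ m.VE b true := by
    rw [VE_eq_bellman m b false, VE_eq_bellman m b true, bellman_eq, bellman_eq]
    have h1 : (1 : ℝ) - m.q false true ≤ 1 - m.q true true :=
      sub_le_sub_left (show (m.q true true : ℝ) ≤ m.q false true from hq1) _
    have h2 : (1 : ℝ) - m.q false false ≤ 1 - m.q true false :=
      sub_le_sub_left (show (m.q true false : ℝ) ≤ m.q false false from hq2) _
    gcongr
  conv_rhs => rw [VE_eq_bellman]
  rw [bellman_eq, bellman_eq]
  set X := 1 + ENNReal.ofReal (1 - m.q s true) * m.VE b true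
  set Y := ENNReal.ofReal (1 - m.q s false) * m.VE b false
  have hYX : Y ≤ X := by
    refine le_trans ?_ le_add_self
    have h1 : (1 : ℝ) - m.q s false ≤ 1 - m.q s true := 
      sub_le_sub_left (show (m.q s true : ℝ) ≤ m.q s false from hq_rew s) _
    exact mul_le_mul' (ENNReal.ofReal_le_ofReal h1) hV
  have ha' : (m.μ a : ℝ) ≤ m.μ b := ha
  have e1 : ENNReal.ofReal (m.μ b) = ENNReal.ofReal (m.μ a) + ENNReal.ofReal (m.μ b - m.μ a) := by
    rw [← ENNReal.ofReal_add (m.μ a).2.1 (sub_nonneg.2 ha')]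
    congr 1; ring
  have e2 : ENNReal.ofReal (1 - m.μ a)
      = ENNReal.ofReal (1 - m.μ b) + ENNReal.ofReal (m.μ b - m.μ a) := by
    rw [← ENNReal.ofReal_add (sub_nonneg.2 (m.μ b).2.2) (sub_nonneg.2 ha')]
    congr 1; ring
  rw [e1, e2, add_mul, add_mul, add_assoc, add_comm (ENNReal.ofReal (1 - m.μ b) * Y)]
  gcongr

end MABA

namespace MABA

variable {M : ℕ}

/-! ### Regret decomposition -/

/-- The indicator that the current episode is among the first `K`. -/
noncomputable def live (K : ℕ) (C : Config M) : ℝ≥0∞ := if C.episode < K then 1 else 0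

/-- The loss incurred by pulling `a` in state `s` and following `b` afterwards. -/
noncomputable def gap (m : MABA M) (b : Fin M) (s : Bool) (a : Fin M) : ℝ≥0∞ :=
  m.VE b s - m.bellman (m.VE b) s a

/-- The expected reward of always pulling `b` from the configuration `C` to the end of the first
`K` episodes. -/
noncomputable def valueToGo (m : MABA M) (b : Fin M) (K : ℕ) (z : ℕ → Bool) (C : Config M) :
    ℝ≥0∞ :=
  if C.episode < K then m.VE b C.state + ∑ j ∈ Finset.Ioo C.episode K, m.VE b (z j) else 0

/-- After abandonment, the value of the new current episode is the first term of the remaining sum,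
so only the rest of the old episode is lost. -/
lemma valueToGo_after (m : MABA M) (b : Fin M) (K : ℕ) (z : ℕ → Bool) (C : Config M)
    (hC : C.episode < K) (a : Fin M) (r d : Bool) :
    m.valueToGo b K z (after z C a r d)
      = (if d then 0 else m.VE b r) + ∑ j ∈ Finset.Ioo C.episode K, m.VE b (z j) := by
  unfold valueToGo after
  cases d with
  | false => simp [hC]
  | true =>
    simp only [if_true, zero_add]
    split_ifs with h
    · rw [← Finset.sum_insert (a := C.episode + 1) (f := fun j => m.VE b (z j)) (by simp)]
      congr 1
      ext j
      simp only [Finset.mem_insert, Finset.mem_Ioo]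
      omega
    · symm
      apply Finset.sum_eq_zero
      intro j hj
      simp only [Finset.mem_Ioo] at hj
      omega

/-- Each pull splits the value to go into the reward, the gap and the value that is left. The
hypothesis `hle` makes the truncated subtraction in `gap` a true one. -/
lemma valueToGo_step (m : MABA M) (b : Fin M) (K : ℕ) (z : ℕ → Bool) (π : Policy M)
    (hle : ∀ s a, m.bellman (m.VE b) s a ≤ m.VE b s) (C : Config M) :
    (live K C * ENNReal.ofReal (m.μ (armAt π C)) + live K C * m.gap b C.state (armAt π C))
      + next m π z (m.valueToGo b K z) C = m.valueToGo b K z C := by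
  by_cases hC : C.episode < K
  · have h1 : ENNReal.ofReal (m.μ (armAt π C)) + next m π z (m.valueToGo b K z) C
        = m.bellman (m.VE b) C.state (armAt π C)
          + ∑ j ∈ Finset.Ioo C.episode K, m.VE b (z j) := by
      have e : ENNReal.ofReal (m.μ (armAt π C))
          = m.avg C.state (armAt π C) fun r _ => if r then 1 else 0 := by
        rw [avg_reward]; simp
      rw [e, next, ← avg_add, bellman,
        ← avg_const m C.state (armAt π C) (∑ j ∈ Finset.Ioo C.episode K, m.VE b (z j)),
        ← avg_add]
      congr 1
      funext r d
      rw [valueToGo_after m b K z C hC, add_assoc]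
    have h2 : m.gap b C.state (armAt π C) + m.bellman (m.VE b) C.state (armAt π C)
        = m.VE b C.state := tsub_add_cancel_of_le (hle _ _)
    simp only [live, hC, if_true, one_mul, valueToGo]
    rw [add_comm (ENNReal.ofReal _), add_assoc, h1, ← add_assoc, h2]
  · have h : ∀ r d, m.valueToGo b K z (after z C (armAt π C) r d) = 0 := by
      intro r d
      unfold valueToGo after
      rw [if_neg]
      cases d <;> simp <;> omega
    simp only [live, hC, if_false, zero_mul, valueToGo, zero_add]
    unfold next
    simp only [h]
    exact avg_const _ _ _ _

/-- Whatever the policy does, reward 0 has probability at least α, and abandonment from state 0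
probability at least β. A Lyapunov function weighing the episodes left and the current state
therefore contracts by a uniform factor. -/
lemma exists_ev_live_le (m : MABA M) (b : Fin M) (hb : ∀ a, m.μ a ≤ m.μ b) (hμ : m.μ b < 1)
    (hq : 0 < m.q false false) :
    ∃ κ : ℝ, 0 ≤ κ ∧ κ < 1 ∧ ∀ (π : Policy M) (z : ℕ → Bool) (K t : ℕ),
      ev m π z t (live K) ≤ ENNReal.ofReal (κ ^ t * 2 ^ (K + 1)) := by
  have hP : (0 : ℝ) < 1 - m.μ b := sub_pos.2 (show (m.μ b : ℝ) < 1 from hμ)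
  have hP0 := (m.μ b).2.1
  have hq0 : (0 : ℝ) < m.q false false := hq
  have hq1 := (m.q false false).2.2
  obtain ⟨α, hα⟩ : ∃ α : ℝ, α = 1 - m.μ b := ⟨_, rfl⟩
  obtain ⟨β, hβ⟩ : ∃ β : ℝ, β = α * m.q false false := ⟨_, rfl⟩
  have hα0 : 0 < α := hα ▸ hP
  have hα1 : α ≤ 1 := by rw [hα]; linarith
  have hβ0 : 0 < β := by rw [hβ]; positivity
  have hβ1 : β ≤ 1 := by rw [hβ]; exact mul_le_one₀ hα1 hq0.le hq1
  have hαβ : α * β ≤ 1 := mul_le_one₀ hα1 hβ0.le hβ1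
  have hαβ0 : 0 < α * β := by positivity
  -- State 0 gets a weight smaller by β/2, so moving from state 1 to state 0 already counts as
  -- progress. The weights stay in [1, 2]: an abandonment halves the power of 2, and this outweighs
  -- any initial state of the next episode.
  set κ : ℝ := 1 - α * β / 4 with hκ
  set g : Bool → ℝ := fun s => if s then 2 else 2 - β / 2 with hg
  have hg1 : ∀ s, 1 ≤ g s := by intro s; cases s <;> simp [hg]; linarith
  have hg2 : ∀ s, g s ≤ 2 := by intro s; cases s <;> simp [hg]; linarith
  have hκ0 : 0 ≤ κ := by rw [hκ]; linarith
  have hstep : ∀ s a, m.avg s a (fun r d => ENNReal.ofReal (if d then 1 else g r))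
      ≤ ENNReal.ofReal (κ * g s) := by
    intro s a
    rw [avg_ofReal m s a (fun r d => if d then 1 else g r) (by
      intro r d
      have := hg1 r
      split_ifs <;> linarith)]
    apply ENNReal.ofReal_le_ofReal
    simp only [if_true, Bool.false_eq_true, if_false]
    have hp := (m.μ a).2
    have hpb : (1 : ℝ) - m.μ a ≥ α := by
      rw [hα]; exact sub_le_sub_left (show (m.μ a : ℝ) ≤ m.μ b from hb a) 1
    have hs1 := (m.q s true).2
    have k1 : (m.μ a : ℝ) * (m.q s true * 1 + (1 - m.q s true) * g true) ≤ m.μ a * 2 := by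
      apply mul_le_mul_of_nonneg_left _ hp.1
      simp only [hg, if_true]
      linarith [hs1.1]
    have h1p := sub_nonneg.2 hp.2
    cases s with
    | true =>
      have hs0 := (m.q true false).2
      have k2 : (1 - m.μ a : ℝ) * (m.q true false * 1 + (1 - m.q true false) * g false)
          ≤ (1 - m.μ a) * (2 - β / 2) := by
        apply mul_le_mul_of_nonneg_left _ h1p
        simp only [hg, Bool.false_eq_true, if_false]
        nlinarith [hs0.1, hs0.2]
      have e : g true = 2 := by simp [hg]
      rw [e] at k1 ⊢
      rw [hκ]
      nlinarith [mul_le_mul_of_nonneg_right hpb hβ0.le]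
    | false =>
      have hs0 := (m.q false false).2
      have k2 : (1 - m.μ a : ℝ) * (m.q false false * 1 + (1 - m.q false false) * g false)
          ≤ (1 - m.μ a) * (2 - m.q false false) := by
        apply mul_le_mul_of_nonneg_left _ h1p
        simp only [hg, Bool.false_eq_true, if_false]
        nlinarith [hs0.1, hs0.2]
      have e : g false = 2 - β / 2 := by simp [hg]
      have k3 : β ≤ (1 - m.μ a) * m.q false false := by
        rw [hβ]; exact mul_le_mul_of_nonneg_right hpb hq0.le
      have k4 : α * β ≤ β := by nlinarith
      have k5 : 0 ≤ α * β * β := by positivity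
      refine (add_le_add k1 k2).trans ?_
      rw [hκ, e]
      nlinarith
  refine ⟨κ, hκ0, by rw [hκ]; linarith, fun π z K t => ?_⟩
  set Ψ : Config M → ℝ≥0∞ := fun C =>
    if C.episode < K then ENNReal.ofReal (2 ^ (K - C.episode)) * ENNReal.ofReal (g C.state) else 0
    with hΨ
  have hnext : ∀ C, next m π z Ψ C ≤ ENNReal.ofReal κ * Ψ C := by
    intro C
    by_cases hC : C.episode < K
    · have h1 : ∀ r d, Ψ (after z C (armAt π C) r d) ≤ ENNReal.ofReal (2 ^ (K - C.episode))
          * ENNReal.ofReal (if d then 1 else g r) := by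
        intro r d
        cases d with
        | false => simp [hΨ, after, hC]
        | true =>
          simp only [hΨ, after, if_true]
          split_ifs with h
          · rw [← ENNReal.ofReal_mul (by positivity), ← ENNReal.ofReal_mul (by positivity)]
            apply ENNReal.ofReal_le_ofReal
            have e : K - C.episode = (K - (C.episode + 1)) + 1 := by omega
            rw [mul_one, e, pow_succ]
            have := hg2 (z (C.episode + 1))
            gcongr
          · exact zero_le
      calc next m π z Ψ C ≤ _ := avg_mono _ _ _ h1
        _ = ENNReal.ofReal (2 ^ (K - C.episode)) * _ := avg_const_mul _ _ _ _ _
        _ ≤ ENNReal.ofReal (2 ^ (K - C.episode)) * ENNReal.ofReal (κ * g C.state) := by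
          gcongr; exact hstep _ _
        _ = ENNReal.ofReal κ * Ψ C := by
          simp only [hΨ, hC, if_true]
          rw [ENNReal.ofReal_mul hκ0]
          ring
    · have h : ∀ r d, Ψ (after z C (armAt π C) r d) = 0 := by
        intro r d
        simp only [hΨ]
        rw [if_neg]
        unfold after
        cases d <;> simp <;> omega
      unfold next
      simp only [h]
      rw [avg_const]
      exact zero_le
  calc ev m π z t (live K) ≤ ev m π z t Ψ := by
        apply ev_mono
        intro C
        simp only [live, hΨ]
        split_ifs
        · rw [← ENNReal.ofReal_mul (by positivity), ← ENNReal.ofReal_one]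
          apply ENNReal.ofReal_le_ofReal
          have := hg1 C.state
          have := one_le_pow₀ (one_le_two (α := ℝ)) (n := K - C.episode)
          nlinarith
        · exact le_rfl
    _ ≤ ENNReal.ofReal κ ^ t * Ψ ⟨0, z 0, []⟩ := ev_le_geometric hnext t
    _ ≤ ENNReal.ofReal κ ^ t * ENNReal.ofReal (2 ^ (K + 1)) := by
        gcongr
        simp only [hΨ]
        split_ifs
        · rw [← ENNReal.ofReal_mul (by positivity)]
          apply ENNReal.ofReal_le_ofReal
          rw [pow_succ, Nat.sub_zero]
          have := hg2 (z 0)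
          gcongr
        · exact zero_le
    _ = _ := by rw [← ENNReal.ofReal_pow hκ0, ← ENNReal.ofReal_mul (by positivity)]

lemma measurable_run_uncurry (π : Policy M) (t : ℕ) :
    Measurable fun ω : (ℕ → Seed M) × (ℕ → Bool) => run π ω.2 ω.1 t := by
  induction t with
  | zero =>
    have : (fun ω : (ℕ → Seed M) × (ℕ → Bool) => run π ω.2 ω.1 0)
        = (fun s : Bool => (⟨0, s, []⟩ : Config M)) ∘ fun ω => ω.2 0 := rfl
    rw [this]
    exact Measurable.of_discrete.comp (by fun_prop)
  | succ t ih =>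
    have h1 : Measurable fun ω : (ℕ → Seed M) × (ℕ → Bool) => ω.1 t := by fun_prop
    have h2 : Measurable fun p : (ℕ → Bool) × Config M => p.1 (p.2.episode + 1) :=
      measurable_from_prod_countable_left fun C => measurable_pi_apply (C.episode + 1)
    have h3 : Measurable fun ω : (ℕ → Seed M) × (ℕ → Bool) =>
        ω.2 ((run π ω.2 ω.1 t).episode + 1) := h2.comp (measurable_snd.prodMk ih)
    exact (Measurable.of_discrete (f := fun p : Seed M × Bool × Config M =>
      step π (fun _ => p.2.1) p.1 p.2.2)).comp (h1.prodMk (h3.prodMk ih))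

lemma measurable_totalReward (π : Policy M) (K : ℕ) :
    Measurable fun ω : (ℕ → Seed M) × (ℕ → Bool) => totalReward π K ω.2 ω.1 := by
  unfold totalReward
  refine Measurable.tsum fun t => ?_
  have h1 : Measurable fun ω : (ℕ → Seed M) × (ℕ → Bool) => ω.1 t := by fun_prop
  exact (Measurable.of_discrete (f := fun p : Seed M × Config M =>
    if p.2.episode < K then rewardAt π p.1 p.2 else 0)).comp
    (h1.prodMk (measurable_run_uncurry π t))

lemma expReward_eq (m : MABA M) (ν : Measure (ℕ → Bool)) [IsProbabilityMeasure ν] (π : Policy M)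
    (K : ℕ) : m.expReward ν π K
      = ∫⁻ z, ∑' t, ev m π z t (fun C => live K C * ENNReal.ofReal (m.μ (armAt π C))) ∂ν := by
  unfold expReward
  rw [lintegral_prod_symm _ (measurable_totalReward π K).aemeasurable]
  refine lintegral_congr fun z => ?_
  unfold totalReward
  have e : ∀ x t, (if (run π z x t).episode < K then rewardAt π (x t) (run π z x t) else 0)
      = live K (run π z x t) * rewardAt π (x t) (run π z x t) := by
    intro x t
    unfold live
    split_ifs <;> simp
  simp only [e]
  rw [lintegral_tsum]
  · exact tsum_congr fun t => ev_reward m π z t (live K)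
  · intro t
    have h1 : Measurable fun x : ℕ → Seed M => x t := by fun_prop
    exact ((Measurable.of_discrete (f := fun p : Seed M × Config M =>
      live K p.2 * rewardAt π p.1 p.2)).comp (h1.prodMk (measurable_run π z t))).aemeasurable

/-- The sum of `valueToGo_step` over time telescopes. The remainder vanishes because the value to go
is at most a constant times `live K`, whose expectation decays geometrically. -/
lemma tsum_ev_reward_add_gap (m : MABA M) (b : Fin M) (hb : ∀ a, m.μ a ≤ m.μ b)
    (hμ : m.μ b < 1) (hq : 0 < m.q false false)
    (hle : ∀ s a, m.bellman (m.VE b) s a ≤ m.VE b s) (π : Policy M) (z : ℕ → Bool) (K : ℕ) :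
    (∑' t, ev m π z t fun C => live K C * ENNReal.ofReal (m.μ (armAt π C)))
      + ∑' t, ev m π z t (fun C => live K C * m.gap b C.state (armAt π C))
      = ∑ j ∈ Finset.range K, m.VE b (z j) := by
  obtain ⟨κ, hκ0, hκ1, hκ⟩ := exists_ev_live_le m b hb hμ hq
  have hsum := sum_ev_add_ev_eq (valueToGo_step m b K z π hle)
  have h0 : m.valueToGo b K z ⟨0, z 0, []⟩ = ∑ j ∈ Finset.range K, m.VE b (z j) := by
    unfold valueToGo
    rcases Nat.eq_zero_or_pos K with rfl | hK
    · simp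
    · rw [if_pos hK]
      have : Finset.range K = insert 0 (Finset.Ioo 0 K) := by
        ext j; simp only [Finset.mem_range, Finset.mem_insert, Finset.mem_Ioo]; omega
      rw [this, Finset.sum_insert (by simp)]
  have hfin : ∀ s, m.VE b s ≠ ∞ := m.VE_ne_top b hμ hq
  set B : ℝ≥0∞ := (m.VE b true + m.VE b false) * (1 + K) with hB
  have hBfin : B ≠ ∞ := ENNReal.mul_ne_top (ENNReal.add_ne_top.2 ⟨hfin _, hfin _⟩)
    (ENNReal.add_ne_top.2 ⟨ENNReal.one_ne_top, ENNReal.natCast_ne_top K⟩)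
  have hle' : ∀ C, m.valueToGo b K z C ≤ B * live K C := by
    intro C
    unfold valueToGo live
    split_ifs
    · have hs : ∀ s, m.VE b s ≤ m.VE b true + m.VE b false := by
        intro s; cases s
        · exact le_add_self
        · exact le_self_add
      calc _ ≤ (m.VE b true + m.VE b false)
            + ∑ j ∈ Finset.Ioo C.episode K, (m.VE b true + m.VE b false) :=
            add_le_add (hs _) (Finset.sum_le_sum fun j _ => hs _)
        _ ≤ (m.VE b true + m.VE b false) + K * (m.VE b true + m.VE b false) := by
            rw [Finset.sum_const, nsmul_eq_mul]
            gcongr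
            simp only [Nat.card_Ioo]
            omega
        _ = B * 1 := by rw [hB]; ring
    · exact zero_le
  have hlim : Tendsto (fun T => ev m π z T (m.valueToGo b K z)) atTop (nhds 0) := by
    have h1 : Tendsto (fun T : ℕ => B * ENNReal.ofReal (κ ^ T * 2 ^ (K + 1))) atTop
        (nhds (B * ENNReal.ofReal (0 * 2 ^ (K + 1)))) :=
      ENNReal.Tendsto.const_mul (ENNReal.tendsto_ofReal
        ((tendsto_pow_atTop_nhds_zero_of_lt_one hκ0 hκ1).mul_const _)) (Or.inr hBfin)
    simp only [zero_mul, ENNReal.ofReal_zero, mul_zero] at h1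
    refine tendsto_of_tendsto_of_tendsto_of_le_of_le tendsto_const_nhds h1
      (fun _ => zero_le) fun T => ?_
    calc _ ≤ ev m π z T fun C => B * live K C := ev_mono hle'
      _ = B * ev m π z T (live K) := ev_const_mul _ _ _
      _ ≤ _ := by gcongr; exact hκ π z K T
  rw [← ENNReal.tsum_add]
  simp only [← ev_add]
  rw [← h0]
  have h2 := (ENNReal.tendsto_nat_tsum (fun t => ev m π z t fun C =>
    live K C * ENNReal.ofReal (m.μ (armAt π C)) + live K C * m.gap b C.state (armAt π C))).add hlim
  simp only [hsum, add_zero] at h2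
  exact (tendsto_nhds_unique h2 tendsto_const_nhds)

/-- The regret is the expected sum of the gaps; a bound that is uniform over the initial states
carries over. -/
lemma regret_le (m : MABA M) (b : Fin M) (hb : ∀ a, m.μ a ≤ m.μ b)
    (hμ : m.μ b < 1) (hq : 0 < m.q false false)
    (hle : ∀ s a, m.bellman (m.VE b) s a ≤ m.VE b s) (ν : Measure (ℕ → Bool))
    [IsProbabilityMeasure ν] (π : Policy M) (K : ℕ) :
    (m.expReward ν (fun _ _ => b) K ≠ ∞ ∧ m.expReward ν π K ≠ ∞) ∧
    ∀ R : ℝ, 0 ≤ R → (∀ z, ∑' t, ev m π z t (fun C => live K C * m.gap b C.state (armAt π C))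
      ≤ ENNReal.ofReal R) → m.regret ν b π K ≤ R := by
  have hfin : ∀ s, m.VE b s ≠ ∞ := m.VE_ne_top b hμ hq
  have hπ := tsum_ev_reward_add_gap m b hb hμ hq hle π
  have hb' := tsum_ev_reward_add_gap m b hb hμ hq hle (fun _ _ => b)
  have hgap0 : ∀ s, m.gap b s b = 0 := by
    intro s
    unfold gap
    rw [← VE_eq_bellman, tsub_self]
  have hconst : ∀ z, ∑' t, ev m (fun _ _ => b) z t
      (fun C => live K C * ENNReal.ofReal (m.μ (armAt (fun _ _ => b) C)))
      = ∑ j ∈ Finset.range K, m.VE b (z j) := by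
    intro z
    rw [← hb' z K]
    simp [armAt, hgap0, ev_const]
  have hS : ∀ z : ℕ → Bool, ∑ j ∈ Finset.range K, m.VE b (z j)
      ≤ K * (m.VE b true + m.VE b false) := by
    intro z
    calc _ ≤ ∑ j ∈ Finset.range K, (m.VE b true + m.VE b false) :=
          Finset.sum_le_sum fun j _ => by
            cases z j
            · exact le_add_self
            · exact le_self_add
      _ = _ := by simp [mul_add]
  have hBfin : (K : ℝ≥0∞) * (m.VE b true + m.VE b false) ≠ ∞ :=
    ENNReal.mul_ne_top (ENNReal.natCast_ne_top K) (ENNReal.add_ne_top.2 ⟨hfin _, hfin _⟩)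
  have hle_fin : ∀ f : (ℕ → Bool) → ℝ≥0∞,
      (∀ z, f z ≤ K * (m.VE b true + m.VE b false)) → ∫⁻ z, f z ∂ν ≠ ∞ := by
    intro f hf
    refine ne_top_of_le_ne_top hBfin ((lintegral_mono hf).trans ?_)
    simp
  have hfin1 : m.expReward ν (fun _ _ => b) K ≠ ∞ := by
    rw [expReward_eq]
    exact hle_fin _ fun z => by rw [hconst]; exact hS z
  have hfin2 : m.expReward ν π K ≠ ∞ := by
    rw [expReward_eq]
    exact hle_fin _ fun z => le_self_add.trans ((hπ z K).le.trans (hS z))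
  refine ⟨⟨hfin1, hfin2⟩, fun R hR0 hR => ?_⟩
  -- The additive form avoids truncated subtraction; real differences are taken only once both sides
  -- are known to be finite.
  have hmain : m.expReward ν (fun _ _ => b) K ≤ m.expReward ν π K + ENNReal.ofReal R := by
    rw [expReward_eq, expReward_eq]
    calc _ ≤ ∫⁻ z, ((∑' t, ev m π z t fun C => live K C * ENNReal.ofReal (m.μ (armAt π C)))
          + ENNReal.ofReal R) ∂ν := by
          refine lintegral_mono fun z => ?_
          simp only [hconst]
          rw [← hπ z K]
          exact add_le_add le_rfl (hR z)
      _ = _ := by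
          rw [lintegral_add_right _ measurable_const]
          simp
  have := ENNReal.toReal_mono (ENNReal.add_ne_top.2 ⟨hfin2, ENNReal.ofReal_ne_top⟩) hmain
  rw [ENNReal.toReal_add hfin2 ENNReal.ofReal_ne_top, ENNReal.toReal_ofReal hR0] at this
  unfold regret
  linarith

end MABA

namespace MABA

variable {M : ℕ}

/-! ### Deviations of the empirical means -/

lemma pulls_cons (y : Sample M) (φ : History M) (a : Fin M) :
    pulls (y :: φ) a = pulls φ a + if y.arm = a then 1 else 0 := by
  unfold pulls
  rw [List.countP_cons]
  simp

lemma rewardSum_cons (y : Sample M) (φ : History M) (a : Fin M) :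
    rewardSum (y :: φ) a = rewardSum φ a + if y.arm = a ∧ y.reward = true then 1 else 0 := by
  unfold rewardSum
  rw [List.countP_cons]
  simp

/-- The likelihood ratio of the samples of arm `a`, for the parameters `θ` and `p`. -/
noncomputable def likelihood (θ p : ℝ) (a : Fin M) (φ : History M) : ℝ≥0∞ :=
  ENNReal.ofReal (θ / p) ^ rewardSum φ a
    * ENNReal.ofReal ((1 - θ) / (1 - p)) ^ (pulls φ a - rewardSum φ a)

lemma likelihood_cons_of_ne (θ p : ℝ) (a : Fin M) (φ : History M) (y : Sample M) (h : y.arm ≠ a) :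
    likelihood θ p a (y :: φ) = likelihood θ p a φ := by
  unfold likelihood
  simp [pulls_cons, rewardSum_cons, h]

lemma likelihood_cons_of_eq (θ p : ℝ) (a : Fin M) (φ : History M) (y : Sample M) (h : y.arm = a) :
    likelihood θ p a (y :: φ) = likelihood θ p a φ *
      if y.reward then ENNReal.ofReal (θ / p) else ENNReal.ofReal ((1 - θ) / (1 - p)) := by
  have hle := rewardSum_le_pulls φ a
  unfold likelihood
  cases hr : y.reward with
  | true =>
    simp only [pulls_cons, rewardSum_cons, h, hr, if_true, and_self]
    rw [Nat.add_sub_add_right, pow_succ]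
    ring
  | false =>
    simp only [pulls_cons, rewardSum_cons, h, hr, if_true, and_false, Bool.false_eq_true,
      if_false, add_zero]
    rw [Nat.sub_add_comm hle, pow_succ]
    ring

/-- The likelihood ratio, stopped at the pull of `a` that follows its first `n` pulls, is a
martingale. -/
lemma sum_ev_likelihood_le (m : MABA M) (π : Policy M) (z : ℕ → Bool) (a : Fin M)
    (h0 : 0 < m.μ a) (h1 : m.μ a < 1) (θ : ℝ) (hθ : θ ∈ Set.Icc (0 : ℝ) 1) (n T : ℕ) :
    (∑ t ∈ Finset.range T, ev m π z t fun C =>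
      if armAt π C = a ∧ pulls C.hist a = n then likelihood θ (m.μ a) a C.hist else 0)
    + ev m π z T (fun C => if pulls C.hist a ≤ n then likelihood θ (m.μ a) a C.hist else 0) ≤ 1 := by
  refine (sum_ev_add_ev_le ?_ T).trans (by simp [likelihood, pulls, rewardSum])
  intro C
  by_cases ha : armAt π C = a
  · by_cases hn : pulls C.hist a < n
    · have e : ∀ r d, (if pulls (after z C (armAt π C) r d).hist a ≤ n
          then likelihood θ (m.μ a) a (after z C (armAt π C) r d).hist else 0)
          = likelihood θ (m.μ a) a C.hist * if r then ENNReal.ofReal (θ / m.μ a)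
            else ENNReal.ofReal ((1 - θ) / (1 - m.μ a)) := by
        intro r d
        have hp : pulls (after z C (armAt π C) r d).hist a ≤ n := by
          simp only [after, pulls_cons, ha, if_true]; omega
        rw [if_pos hp]
        exact likelihood_cons_of_eq _ _ _ _ _ ha
      have hp0 : (0 : ℝ) < m.μ a := h0
      have hp1 : (0 : ℝ) < 1 - m.μ a := sub_pos.2 (show (m.μ a : ℝ) < 1 from h1)
      have e2 : next m π z (fun C => if pulls C.hist a ≤ n
          then likelihood θ (m.μ a) a C.hist else 0) C = likelihood θ (m.μ a) a C.hist := by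
        unfold next
        simp only [e]
        rw [avg_const_mul, avg_reward]
        simp only [if_true, Bool.false_eq_true, if_false, ha]
        rw [← ENNReal.ofReal_mul hp0.le, ← ENNReal.ofReal_mul hp1.le, mul_div_cancel₀ _ hp0.ne',
          mul_div_cancel₀ _ hp1.ne', ← ENNReal.ofReal_add hθ.1 (sub_nonneg.2 hθ.2)]
        simp
      rw [e2, if_neg (by omega), if_pos hn.le, zero_add]
    -- With exactly n earlier pulls, this pull moves the whole mass from the potential into the
    -- running cost; with more than n, both are already zero.
    · have e2 : next m π z (fun C => if pulls C.hist a ≤ n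
          then likelihood θ (m.μ a) a C.hist else 0) C = 0 := by
        refine Eq.trans ?_ (avg_const m C.state (armAt π C) 0)
        unfold next
        congr 1
        funext r d
        refine if_neg ?_
        simp only [after, pulls_cons, ha, if_true]; omega
      rw [e2, add_zero]
      by_cases hn' : pulls C.hist a = n
      · simp [ha, hn']
      · simp [hn']
  · have e2 : next m π z (fun C => if pulls C.hist a ≤ n
          then likelihood θ (m.μ a) a C.hist else 0) C
        = if pulls C.hist a ≤ n then likelihood θ (m.μ a) a C.hist else 0 := by
      refine Eq.trans ?_ (avg_const m C.state (armAt π C) _)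
      unfold next
      congr 1
      funext r d
      dsimp only
      have : pulls (after z C (armAt π C) r d).hist a = pulls C.hist a := by
        simp [after, pulls_cons, ha]
      rw [this]
      congr 1
      exact likelihood_cons_of_ne _ _ _ _ _ ha
    rw [e2]
    simp [ha]

lemma pow_eq_exp_mul_log {u : ℝ} {k : ℕ} (h : k = 0 ∨ 0 < u) :
    u ^ k = Real.exp (k * Real.log u) := by
  rcases h with rfl | h
  · simp
  · rw [Real.exp_nat_mul, Real.exp_log h]

/-- At the maximum likelihood parameter the log-likelihood ratio is n times the divergence. When the
empirical mean is 0 or 1, the factor with base 0 has exponent 0, which is why `pow_eq_exp_mul_log`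
allows k = 0. -/
lemma likelihood_empMean (a : Fin M) (φ : History M) (p : ℝ) (hp : p ∈ Set.Ioo (0 : ℝ) 1)
    (hn : pulls φ a ≠ 0) :
    likelihood (empMean φ a) p a φ
      = ENNReal.ofReal (Real.exp (pulls φ a * klReal (empMean φ a) p)) := by
  have hle := rewardSum_le_pulls φ a
  have hn' : (0 : ℝ) < pulls φ a := by exact_mod_cast Nat.pos_of_ne_zero hn
  have he : (empMean φ a : ℝ) = (rewardSum φ a : ℝ) / pulls φ a := rfl
  have h1p : 0 < 1 - p := sub_pos.2 hp.2
  have hx := (empMean φ a).2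
  unfold likelihood klReal
  rw [← ENNReal.ofReal_pow (div_nonneg hx.1 hp.1.le),
    ← ENNReal.ofReal_pow (div_nonneg (sub_nonneg.2 hx.2) h1p.le),
    ← ENNReal.ofReal_mul (pow_nonneg (div_nonneg hx.1 hp.1.le) _)]
  congr 1
  rw [pow_eq_exp_mul_log, pow_eq_exp_mul_log, ← Real.exp_add]
  · congr 1
    have e1 : (rewardSum φ a : ℝ) = pulls φ a * empMean φ a := by
      rw [he]; field_simp
    rw [Nat.cast_sub hle, e1]
    ring
  · rcases hle.eq_or_lt with h | h
    · left; omega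
    · right
      apply div_pos _ h1p
      rw [sub_pos, he, div_lt_one hn']
      exact_mod_cast h
  · rcases Nat.eq_zero_or_pos (rewardSum φ a) with h | h
    · left; exact h
    · right
      apply div_pos _ hp.1
      rw [he]
      have : (0 : ℝ) < rewardSum φ a := by exact_mod_cast h
      positivity

/-- The empirical mean of arm `a` lies beyond the threshold `w`, as seen from its mean. -/
def Deviates (m : MABA M) (a : Fin M) (w : ℝ) (φ : History M) : Prop :=
  pulls φ a ≠ 0 ∧ Between (empMean φ a) w (m.μ a)

/-- A bound on the expected number of deviations, in terms of the divergence `c` between the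
threshold and the mean. -/
noncomputable def devConst (c : ℝ) : ℝ≥0∞ :=
  ∑' n : ℕ, ENNReal.ofReal (((n : ℝ) + 1) * Real.exp (-(n * (c / 2))))

lemma devConst_ne_top {c : ℝ} (hc : 0 < c) : devConst c ≠ ∞ := by
  have hr : ‖Real.exp (-(c / 2))‖ < 1 := by
    rw [Real.norm_eq_abs, abs_of_pos (Real.exp_pos _), Real.exp_lt_one_iff]
    linarith
  have e : ∀ n : ℕ, ((n : ℝ) + 1) * Real.exp (-(n * (c / 2)))
      = (n : ℝ) ^ 1 * Real.exp (-(c / 2)) ^ n + Real.exp (-(c / 2)) ^ n := by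
    intro n
    rw [← Real.exp_nat_mul]
    ring_nf
  have hs : Summable fun n : ℕ => ((n : ℝ) + 1) * Real.exp (-(n * (c / 2))) := by
    simp only [e]
    exact (summable_pow_mul_geometric_of_norm_lt_one 1 hr).add
      (summable_geometric_of_norm_lt_one hr)
  unfold devConst
  rw [← ENNReal.ofReal_tsum_of_nonneg (fun n => by positivity) hs]
  exact ENNReal.ofReal_ne_top

section deviation

variable (m : MABA M) (π : Policy M) (z : ℕ → Bool) (a : Fin M) {w : ℝ}

/-- `klReal_pythagoras` leaves a surplus n kl(w, μ(a)). One half stays on the left; the other half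
becomes the factor on the right that makes the sum over n converge. -/
lemma Deviates.exp_le {m : MABA M} {a : Fin M} (h0 : 0 < m.μ a) (h1 : m.μ a < 1)
    (hw : w ∈ Set.Ioo (0 : ℝ) 1) {φ : History M} (h : Deviates m a w φ) :
    ENNReal.ofReal (Real.exp (pulls φ a * klReal (empMean φ a) w
      + pulls φ a * (klReal w (m.μ a) / 2)))
    ≤ ENNReal.ofReal (Real.exp (-(pulls φ a * (klReal w (m.μ a) / 2))))
      * likelihood ((rewardSum φ a : ℝ) / pulls φ a) (m.μ a) a φ := by
  have hp : (m.μ a : ℝ) ∈ Set.Ioo (0 : ℝ) 1 := ⟨h0, h1⟩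
  have hpy := klReal_pythagoras (empMean φ a).2 hw hp h.2
  have e := likelihood_empMean a φ _ hp h.1
  have he : (empMean φ a : ℝ) = (rewardSum φ a : ℝ) / pulls φ a := rfl
  rw [he] at e hpy
  rw [e, he, ← ENNReal.ofReal_mul (Real.exp_pos _).le, ← Real.exp_add]
  apply ENNReal.ofReal_le_ofReal
  apply Real.exp_le_exp.2
  have hn : (0 : ℝ) ≤ pulls φ a := Nat.cast_nonneg _
  nlinarith [mul_le_mul_of_nonneg_left hpy hn]

/-- A union bound over the number n of pulls and the number k ≤ n of successes; the n + 1 values of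
k give the polynomial factor in `devConst`. -/
lemma tsum_sum_le_devConst (c : ℝ) (F : ℕ → ℕ → ℝ≥0∞)
    (hF : ∀ n, ∀ k ∈ Finset.range (n + 1), F n k ≤ 1) :
    ∑' n : ℕ, ∑ k ∈ Finset.range (n + 1), ENNReal.ofReal (Real.exp (-(n * (c / 2)))) * F n k
      ≤ devConst c := by
  refine ENNReal.tsum_le_tsum fun n => ?_
  calc _ ≤ ∑ k ∈ Finset.range (n + 1), ENNReal.ofReal (Real.exp (-(n * (c / 2)))) :=
        Finset.sum_le_sum fun k hk => mul_le_of_le_one_right' (hF n k hk)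
    _ = _ := by
        rw [Finset.sum_const, Finset.card_range, nsmul_eq_mul, ENNReal.ofReal_mul (by positivity)]
        congr 1
        rw [ENNReal.ofReal_add (by positivity) zero_le_one]
        simp

lemma le_tsum_sum (G : ℕ → ℕ → ℝ≥0∞) (n k : ℕ) (hk : k ≤ n) :
    G n k ≤ ∑' n : ℕ, ∑ k ∈ Finset.range (n + 1), G n k :=
  (Finset.single_le_sum (f := G n) (fun _ _ => zero_le)
    (Finset.mem_range.2 (Nat.lt_succ_of_le hk))).trans (ENNReal.le_tsum n)

lemma div_mem_Icc {n k : ℕ} (h : k ∈ Finset.range (n + 1)) :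
    ((k : ℝ) / n) ∈ Set.Icc (0 : ℝ) 1 :=
  ⟨by positivity, div_le_one_of_le₀ (by exact_mod_cast Nat.lt_succ_iff.1 (Finset.mem_range.1 h))
    (by positivity)⟩

open Classical in
-- An exponential moment at a fixed time, although the number of pulls is random: the observed pair
-- (n, k) is one term of the union bound, and each martingale has mean at most 1. Either summand of
-- the exponent can be played against the bonus.
lemma ev_deviates_exp_le (h0 : 0 < m.μ a) (h1 : m.μ a < 1) (hw : w ∈ Set.Ioo (0 : ℝ) 1) (T : ℕ) :
    ev m π z T (fun C => if Deviates m a w C.hist then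
      ENNReal.ofReal (Real.exp (pulls C.hist a * klReal (empMean C.hist a) w
        + pulls C.hist a * (klReal w (m.μ a) / 2))) else 0) ≤ devConst (klReal w (m.μ a)) := by
  refine le_trans (ev_mono (g := fun C => ∑' n : ℕ, ∑ k ∈ Finset.range (n + 1),
    ENNReal.ofReal (Real.exp (-(n * (klReal w (m.μ a) / 2))))
      * if pulls C.hist a ≤ n then likelihood ((k : ℝ) / n) (m.μ a) a C.hist else 0) ?_) ?_
  · intro C
    split_ifs with h
    · refine le_trans ?_ (le_tsum_sum _ (pulls C.hist a) (rewardSum C.hist a)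
        (rewardSum_le_pulls _ _))
      rw [if_pos le_rfl]
      exact h.exp_le h0 h1 hw
    · exact zero_le
  · rw [ev_tsum]
    simp only [ev_finset_sum, ev_const_mul]
    exact tsum_sum_le_devConst _ (fun n k => ev m π z T fun C =>
      if pulls C.hist a ≤ n then likelihood ((k : ℝ) / n) (m.μ a) a C.hist else 0) fun n k hk =>
      le_add_self.trans (sum_ev_likelihood_le m π z a h0 h1 _ (div_mem_Icc hk) n T)

open Classical in
-- Each n is met by at most one pull of a, so the running cost of the stopped martingale bounds the
-- sum over all times at once, without a union bound over t.
lemma sum_ev_deviates_le (h0 : 0 < m.μ a) (h1 : m.μ a < 1) (hw : w ∈ Set.Ioo (0 : ℝ) 1) (T : ℕ) :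
    ∑ t ∈ Finset.range T, ev m π z t (fun C =>
      if armAt π C = a ∧ Deviates m a w C.hist then 1 else 0) ≤ devConst (klReal w (m.μ a)) := by
  have hpt : ∀ C : Config M, (if armAt π C = a ∧ Deviates m a w C.hist then (1 : ℝ≥0∞) else 0)
      ≤ ∑' n : ℕ, ∑ k ∈ Finset.range (n + 1),
        ENNReal.ofReal (Real.exp (-(n * (klReal w (m.μ a) / 2)))) *
        if armAt π C = a ∧ pulls C.hist a = n
          then likelihood ((k : ℝ) / n) (m.μ a) a C.hist else 0 := by
    intro C
    split_ifs with h
    · refine le_trans ?_ (le_tsum_sum _ (pulls C.hist a) (rewardSum C.hist a)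
        (rewardSum_le_pulls _ _))
      rw [if_pos ⟨h.1, rfl⟩]
      refine le_trans ?_ (h.2.exp_le h0 h1 hw)
      rw [← ENNReal.ofReal_one]
      apply ENNReal.ofReal_le_ofReal
      apply Real.one_le_exp
      have k1 := klReal_nonneg (empMean C.hist a).2 hw
      have k2 := klReal_nonneg ⟨hw.1.le, hw.2.le⟩ (⟨h0, h1⟩ : (m.μ a : ℝ) ∈ Set.Ioo (0 : ℝ) 1)
      positivity
    · exact zero_le
  calc _ ≤ ∑ t ∈ Finset.range T, ∑' n : ℕ, ∑ k ∈ Finset.range (n + 1),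
        ENNReal.ofReal (Real.exp (-(n * (klReal w (m.μ a) / 2)))) * ev m π z t fun C =>
        if armAt π C = a ∧ pulls C.hist a = n
          then likelihood ((k : ℝ) / n) (m.μ a) a C.hist else 0 := by
        refine Finset.sum_le_sum fun t _ => (ev_mono hpt).trans ?_
        rw [ev_tsum]
        simp only [ev_finset_sum, ev_const_mul]
        exact le_rfl
    _ = ∑' n : ℕ, ∑ k ∈ Finset.range (n + 1),
        ENNReal.ofReal (Real.exp (-(n * (klReal w (m.μ a) / 2)))) *
        ∑ t ∈ Finset.range T, ev m π z t fun C =>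
        if armAt π C = a ∧ pulls C.hist a = n
          then likelihood ((k : ℝ) / n) (m.μ a) a C.hist else 0 := by
        rw [← Summable.tsum_finsetSum fun _ _ => ENNReal.summable]
        refine tsum_congr fun n => ?_
        rw [Finset.sum_comm]
        simp only [Finset.mul_sum]
    _ ≤ _ := tsum_sum_le_devConst _ _ fun n k hk =>
        le_self_add.trans (sum_ev_likelihood_le m π z a h0 h1 _ (div_mem_Icc hk) n T)

end deviation

/-! ### Visits of state 1 -/

/-- The number of past steps spent in state 1. -/
def visits (φ : History M) : ℕ := φ.countP fun y => y.state = true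

lemma visits_cons (y : Sample M) (φ : History M) :
    visits (y :: φ) = visits φ + if y.state = true then 1 else 0 := by
  unfold visits
  rw [List.countP_cons]
  simp

/-- Under every policy each step leads to state 1 with probability at least some p > 0, so the
exponential moment of minus the number of visits contracts. -/
lemma exists_ev_visits_le (m : MABA M) (b : Fin M) (hb : ∀ a, m.μ b ≤ m.μ a) (hb0 : 0 < m.μ b)
    (hq : ∀ s, m.q s true < 1) :
    ∃ κ : ℝ, 0 < κ ∧ κ < 1 ∧ ∀ (π : Policy M) (z : ℕ → Bool) (t : ℕ),
      ev m π z t (fun C => ENNReal.ofReal (Real.exp (-(visits C.hist : ℝ))))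
        ≤ ENNReal.ofReal (Real.exp 1 * κ ^ t) := by
  have hb0' : (0 : ℝ) < m.μ b := hb0
  have hq' : ∀ s, (0 : ℝ) < 1 - m.q s true := fun s => sub_pos.2 (show (m.q s true : ℝ) < 1 from hq s)
  -- The product of the two survival probabilities is below each of them, so one p serves both
  -- states.
  set p : ℝ := m.μ b * ((1 - m.q true true) * (1 - m.q false true)) with hp
  have hp0 : 0 < p := mul_pos hb0' (mul_pos (hq' _) (hq' _))
  have hpa : ∀ s a, p ≤ m.μ a * (1 - m.q s true) := by
    intro s a
    have ha : (m.μ b : ℝ) ≤ m.μ a := hb a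
    refine mul_le_mul ha ?_ (mul_pos (hq' _) (hq' _)).le (m.μ a).2.1
    have h1 := (m.q true true).2.1
    have h2 := (m.q false true).2.1
    have h3 := hq' true
    have h4 := hq' false
    cases s <;> nlinarith
  have hp1 : p ≤ 1 := (hpa true b).trans (mul_le_one₀ (m.μ b).2.2 (hq' _).le
    (by linarith [(m.q true true).2.1]))
  have he : Real.exp (-1) < 1 := by rw [Real.exp_lt_one_iff]; norm_num
  have he0 := Real.exp_pos (-1)
  set κ : ℝ := 1 - p * (1 - Real.exp (-1)) with hκ
  have hκ1 : κ < 1 := by rw [hκ]; nlinarith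
  have hκ0 : 0 < κ := by rw [hκ]; nlinarith
  refine ⟨κ, hκ0, hκ1, fun π z t => ?_⟩
  -- The current state is not yet in the history; h counts it in advance. After abandonment the new
  -- state is arbitrary, so only the bound h ≤ 1 is used.
  set h : Bool → ℝ := fun s => if s then Real.exp (-1) else 1 with hh
  have hpos : ∀ s, 0 < h s := by intro s; cases s <;> simp [hh, Real.exp_pos]
  have hle1 : ∀ s, h s ≤ 1 := by intro s; cases s <;> simp [hh]
  set Ψ : Config M → ℝ≥0∞ := fun C =>
    ENNReal.ofReal (Real.exp (-(visits C.hist : ℝ)) * h C.state) with hΨ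
  have hstep : ∀ C, next m π z Ψ C ≤ ENNReal.ofReal κ * Ψ C := by
    intro C
    have e : ∀ r d, Ψ (after z C (armAt π C) r d)
        ≤ Ψ C * ENNReal.ofReal (if d then 1 else h r) := by
      intro r d
      simp only [hΨ]
      rw [← ENNReal.ofReal_mul (mul_pos (Real.exp_pos _) (hpos _)).le]
      apply ENNReal.ofReal_le_ofReal
      have e1 : Real.exp (-(visits (after z C (armAt π C) r d).hist : ℝ))
          = Real.exp (-(visits C.hist : ℝ)) * h C.state := by
        simp only [after, visits_cons, hh]
        split_ifs
        · rw [← Real.exp_add]; push_cast; ring_nf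
        · simp
      rw [e1]
      refine mul_le_mul_of_nonneg_left ?_ (mul_pos (Real.exp_pos _) (hpos _)).le
      cases d
      · simp [after]
      · simpa [after] using hle1 _
    have e2 : m.avg C.state (armAt π C) (fun r d => ENNReal.ofReal (if d then 1 else h r))
        ≤ ENNReal.ofReal κ := by
      rw [avg_ofReal m _ _ (fun r d => if d then 1 else h r) (by
        intro r d
        have := (hpos r).le
        split_ifs <;> linarith)]
      apply ENNReal.ofReal_le_ofReal
      simp only [if_true, Bool.false_eq_true, if_false, hh]
      have := hpa C.state (armAt π C)
      rw [hκ]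
      nlinarith
    calc next m π z Ψ C ≤ m.avg C.state (armAt π C)
          (fun r d => Ψ C * ENNReal.ofReal (if d then 1 else h r)) := avg_mono _ _ _ e
      _ = Ψ C * _ := avg_const_mul _ _ _ _ _
      _ ≤ Ψ C * ENNReal.ofReal κ := by gcongr
      _ = _ := mul_comm _ _
  calc _ ≤ ev m π z t (fun C => ENNReal.ofReal (Real.exp 1) * Ψ C) := by
        apply ev_mono
        intro C
        simp only [hΨ]
        rw [← ENNReal.ofReal_mul (Real.exp_pos _).le]
        apply ENNReal.ofReal_le_ofReal
        have h1 : 1 ≤ Real.exp 1 * h C.state := by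
          simp only [hh]
          split_ifs
          · rw [← Real.exp_add]; simp
          · rw [mul_one]; exact Real.one_le_exp zero_le_one
        nlinarith [Real.exp_pos (-(visits C.hist : ℝ))]
    _ = ENNReal.ofReal (Real.exp 1) * ev m π z t Ψ := ev_const_mul _ _ _
    _ ≤ ENNReal.ofReal (Real.exp 1) * (ENNReal.ofReal κ ^ t * Ψ ⟨0, z 0, []⟩) := by
        gcongr
        exact ev_le_geometric hstep t
    _ ≤ ENNReal.ofReal (Real.exp 1) * (ENNReal.ofReal κ ^ t * 1) := by
        gcongr
        simp only [hΨ, visits]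
        rw [← ENNReal.ofReal_one]
        apply ENNReal.ofReal_le_ofReal
        simpa using hle1 (z 0)
    _ = _ := by
        rw [mul_one, ← ENNReal.ofReal_pow hκ0.le, ← ENNReal.ofReal_mul (Real.exp_pos _).le]

end MABA

namespace MABA

variable {M : ℕ}

/-! ### The exploration bonus -/

/-- The right-hand side of the condition that defines the confidence sets, after `ℓ` steps. -/
noncomputable def bonus (ℓ : ℕ) : ℝ :=
  1 * Real.log ((ℓ : ℝ) + 1) + 4 * Real.log (Real.log ((ℓ : ℝ) + 1))

/-- A nonnegative bound on the bonuses up to `t` steps. -/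
noncomputable def maxBonus (t : ℕ) : ℝ :=
  Real.log ((t : ℝ) + 3) + 4 * Real.log (Real.log ((t : ℝ) + 3))

lemma one_lt_log_add_three (t : ℕ) : 1 < Real.log ((t : ℝ) + 3) := by
  rw [Real.lt_log_iff_exp_lt (by positivity)]
  have := Real.exp_one_lt_d9
  have : (0 : ℝ) ≤ t := Nat.cast_nonneg t
  linarith

lemma maxBonus_nonneg (t : ℕ) : 0 ≤ maxBonus t := by
  have := one_lt_log_add_three t
  have := Real.log_pos this
  unfold maxBonus
  linarith

lemma bonus_le_maxBonus {ℓ t : ℕ} (h : ℓ ≤ t) : bonus ℓ ≤ maxBonus t := by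
  -- At ℓ = 0 the convention log 0 = 0 makes the bonus zero.
  rcases Nat.eq_zero_or_pos ℓ with rfl | hℓ
  · simpa [bonus] using maxBonus_nonneg t
  · have h' : (ℓ : ℝ) ≤ t := by exact_mod_cast h
    have hℓ' : (1 : ℝ) ≤ ℓ := by exact_mod_cast hℓ
    have h1 : Real.log ((ℓ : ℝ) + 1) ≤ Real.log ((t : ℝ) + 3) :=
      Real.log_le_log (by linarith) (by linarith)
    have h2 := Real.log_le_log (Real.log_pos (by linarith)) h1
    unfold bonus maxBonus
    linarith

lemma maxBonus_le (t : ℕ) : maxBonus t ≤ 5 * Real.log ((t : ℝ) + 3) := by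
  have := Real.log_le_self (zero_lt_one.trans (one_lt_log_add_three t)).le
  unfold maxBonus
  linarith

/-- The terms are 1 / (v (log v)^4) with v = ℓ + 1. After a shift that makes the logarithms exceed
1, they are dominated by the telescoping differences 1/log(v - 1) - 1/log v. -/
lemma summable_exp_neg_bonus : Summable fun ℓ : ℕ => Real.exp (-bonus ℓ) := by
  rw [← summable_nat_add_iff 3]
  have hlog : ∀ ℓ : ℕ, 1 < Real.log ((ℓ : ℝ) + 3) := one_lt_log_add_three
  have hterm : ∀ ℓ : ℕ, Real.exp (-bonus (ℓ + 3))
      ≤ (Real.log ((ℓ : ℝ) + 3))⁻¹ - (Real.log (((ℓ + 1 : ℕ) : ℝ) + 3))⁻¹ := by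
    intro ℓ
    have hℓ : (0 : ℝ) ≤ ℓ := Nat.cast_nonneg ℓ
    have hA := hlog ℓ
    have hB := hlog (ℓ + 1)
    set A := Real.log ((ℓ : ℝ) + 3) with hAdef
    set B := Real.log (((ℓ + 1 : ℕ) : ℝ) + 3) with hBdef
    have hc : (((ℓ + 3 : ℕ) : ℝ) + 1) = ((ℓ + 1 : ℕ) : ℝ) + 3 := by push_cast; ring
    have hv : (0 : ℝ) < ((ℓ + 1 : ℕ) : ℝ) + 3 := by positivity
    have e1 : Real.exp (-bonus (ℓ + 3)) = ((((ℓ + 1 : ℕ) : ℝ) + 3) * B ^ 4)⁻¹ := by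
      unfold bonus
      rw [Real.exp_neg, hc, ← hBdef, Real.exp_add, one_mul, hBdef, Real.exp_log hv, ← hBdef]
      congr 2
      have : (4 : ℝ) * Real.log B = (4 : ℕ) * Real.log B := by norm_num
      rw [this, Real.exp_nat_mul, Real.exp_log (by linarith)]
    have h1 : (((ℓ + 1 : ℕ) : ℝ) + 3)⁻¹ ≤ B - A := by
      rw [hAdef, hBdef, ← Real.log_div (by positivity) (by positivity)]
      refine le_trans ?_ (Real.one_sub_inv_le_log_of_pos (by positivity))
      push_cast
      field_simp
      linarith
    have hAB : A ≤ B := by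
      have : 0 ≤ (((ℓ + 1 : ℕ) : ℝ) + 3)⁻¹ := by positivity
      linarith
    rw [e1, mul_inv]
    have hA0 : 0 < A := by linarith
    have hB0 : 0 < B := by linarith
    have e2 : A⁻¹ - B⁻¹ = (B - A) * (A * B)⁻¹ := by field_simp
    rw [e2]
    refine mul_le_mul h1 (inv_anti₀ (by positivity) ?_) (by positivity) (by linarith)
    have : A * B ≤ B * B := by nlinarith
    have : B * B ≤ B ^ 4 := by
      have : 1 ≤ B * B := by nlinarith
      nlinarith [mul_pos hB0 hB0]
    linarith
  refine summable_of_sum_range_le (c := (Real.log 3)⁻¹) (fun ℓ => (Real.exp_pos _).le) fun n => ?_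
  have hsum : ∑ ℓ ∈ Finset.range n, Real.exp (-bonus (ℓ + 3))
      ≤ (Real.log (((0 : ℕ) : ℝ) + 3))⁻¹ - (Real.log ((n : ℝ) + 3))⁻¹ := by
    rw [← Finset.sum_range_sub' (fun ℓ : ℕ => (Real.log ((ℓ : ℝ) + 3))⁻¹)]
    exact Finset.sum_le_sum fun ℓ _ => hterm ℓ
  refine hsum.trans ?_
  have := inv_nonneg.2 (zero_lt_one.trans (hlog n)).le
  simp only [Nat.cast_zero, zero_add]
  linarith

lemma sum_ofReal_exp_neg_bonus_le (T : ℕ) :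
    ∑ t ∈ Finset.range T, ENNReal.ofReal (Real.exp (-bonus t))
      ≤ ENNReal.ofReal (∑' t, Real.exp (-bonus t)) := by
  rw [← ENNReal.ofReal_sum_of_nonneg fun _ _ => (Real.exp_pos _).le]
  exact ENNReal.ofReal_le_ofReal
    (summable_exp_neg_bonus.sum_le_tsum _ fun _ _ => (Real.exp_pos _).le)

/-! ### The indices -/

lemma mem_confSet_iff (φ : History M) (a : Fin M) (p : I) :
    p ∈ confSet 1 4 φ a ↔ kl (empMean φ a) p * (pulls φ a : ℝ≥0∞)
      ≤ ENNReal.ofReal (bonus φ.length) := Iff.rfl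

lemma empMean_mem_confSet (φ : History M) (a : Fin M) : empMean φ a ∈ confSet 1 4 φ a := by
  rw [mem_confSet_iff]
  simp [kl]

lemma bonus_lt_of_notMem {φ : History M} {a : Fin M} {x : I} (hx : (x : ℝ) ∈ Set.Ioo (0 : ℝ) 1)
    (h : x ∉ confSet 1 4 φ a) : bonus φ.length < pulls φ a * klReal (empMean φ a) x := by
  rw [mem_confSet_iff, not_le, kl_eq_ofReal _ _ hx, ← ENNReal.ofReal_natCast,
    ← ENNReal.ofReal_mul (klReal_nonneg (empMean φ a).2 hx), mul_comm] at h
  exact lt_of_not_ge fun h' => h.not_ge (ENNReal.ofReal_le_ofReal h')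

lemma le_of_mem_confSet {φ : History M} {a : Fin M} {x : I} (hx : (x : ℝ) ∈ Set.Ioo (0 : ℝ) 1)
    (h : x ∈ confSet 1 4 φ a) {t : ℕ} (ht : φ.length ≤ t) :
    pulls φ a * klReal (empMean φ a) x ≤ maxBonus t := by
  rw [mem_confSet_iff, kl_eq_ofReal _ _ hx, ← ENNReal.ofReal_natCast,
    ← ENNReal.ofReal_mul (klReal_nonneg (empMean φ a).2 hx), mul_comm] at h
  exact (ENNReal.ofReal_le_ofReal_iff (maxBonus_nonneg t)).1
    (h.trans (ENNReal.ofReal_le_ofReal (bonus_le_maxBonus ht)))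

lemma bddAbove_confSet (φ : History M) (a : Fin M) :
    BddAbove (((↑) : I → ℝ) '' confSet 1 4 φ a) :=
  ⟨1, by rintro _ ⟨p, _, rfl⟩; exact p.2.2⟩

lemma bddBelow_confSet (φ : History M) (a : Fin M) :
    BddBelow (((↑) : I → ℝ) '' confSet 1 4 φ a) :=
  ⟨0, by rintro _ ⟨p, _, rfl⟩; exact p.2.1⟩

lemma of_upperIndex_lt {φ : History M} {a : Fin M} {x : I}
    (h : klIndex 1 1 4 true φ a < x) : (empMean φ a : ℝ) ≤ x ∧ x ∉ confSet 1 4 φ a := by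
  simp only [klIndex, if_true] at h
  refine ⟨(le_csSup (bddAbove_confSet φ a) ⟨_, empMean_mem_confSet φ a, rfl⟩).trans h.le, fun hx => ?_⟩
  exact (le_csSup (bddAbove_confSet φ a) ⟨x, hx, rfl⟩).not_gt h

lemma of_lt_lowerIndex {φ : History M} {a : Fin M} {x : I}
    (h : (x : ℝ) < klIndex 1 1 4 false φ a) :
    (x : ℝ) ≤ empMean φ a ∧ x ∉ confSet 1 4 φ a := by
  simp only [klIndex, Bool.false_eq_true, if_false] at h
  refine ⟨h.le.trans (csInf_le (bddBelow_confSet φ a) ⟨_, empMean_mem_confSet φ a, rfl⟩), fun hx => ?_⟩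
  exact (csInf_le (bddBelow_confSet φ a) ⟨x, hx, rfl⟩).not_gt h

lemma mem_confSet_of_mem {φ : History M} {a : Fin M} {y p : I}
    (hy : (y : ℝ) ∈ Set.Ioo (0 : ℝ) 1) (hp : p ∈ confSet 1 4 φ a)
    (h : Between (empMean φ a) y p) : y ∈ confSet 1 4 φ a := by
  rw [mem_confSet_iff] at hp ⊢
  exact (mul_le_mul_left (kl_mono_right hy h) _).trans hp

/-- A strict inequality provides a member of the confidence set beyond y, and monotonicity of the
divergence does the rest; the supremum need not be attained. -/
lemma mem_confSet_of_lt_upperIndex {φ : History M} {a : Fin M} {y : I}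
    (hy : (y : ℝ) ∈ Set.Ioo (0 : ℝ) 1) (hm : (empMean φ a : ℝ) ≤ y)
    (h : (y : ℝ) < klIndex 1 1 4 true φ a) : y ∈ confSet 1 4 φ a := by
  simp only [klIndex, if_true] at h
  obtain ⟨_, ⟨p, hp, rfl⟩, hyp⟩ :=
    exists_lt_of_lt_csSup (Set.Nonempty.image _ ⟨_, empMean_mem_confSet φ a⟩) h
  exact mem_confSet_of_mem hy hp (Or.inl ⟨hm, hyp.le⟩)

lemma mem_confSet_of_lowerIndex_lt {φ : History M} {a : Fin M} {y : I}
    (hy : (y : ℝ) ∈ Set.Ioo (0 : ℝ) 1) (hm : (y : ℝ) ≤ empMean φ a)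
    (h : klIndex 1 1 4 false φ a < y) : y ∈ confSet 1 4 φ a := by
  simp only [klIndex, Bool.false_eq_true, if_false] at h
  obtain ⟨_, ⟨p, hp, rfl⟩, hyp⟩ :=
    exists_lt_of_csInf_lt (Set.Nonempty.image _ ⟨_, empMean_mem_confSet φ a⟩) h
  exact mem_confSet_of_mem hy hp (Or.inr ⟨hyp.le, hm⟩)

/-! ### Decisions of the algorithm -/

/-- Thresholds that separate the means of the suboptimal arms from the mean of the best arm `b`. -/
structure Thresholds (m : MABA M) (b : Fin M) where
  w : Fin M → I
  y : I
  x : I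
  pos : ∀ a, 0 < m.μ a
  lt_w : ∀ a, a ≠ b → m.μ a < w a
  w_lt : ∀ a, a ≠ b → w a < y
  y_lt : y < x
  x_lt : x < m.μ b
  lt_one : m.μ b < 1

namespace Thresholds

variable {m : MABA M} {b : Fin M}

lemma x_mem (τ : Thresholds m b) : (τ.x : ℝ) ∈ Set.Ioo (0 : ℝ) 1 :=
  ⟨lt_of_le_of_lt τ.y.2.1 τ.y_lt, lt_trans (show (τ.x : ℝ) < m.μ b from τ.x_lt) τ.lt_one⟩

lemma μb_mem (τ : Thresholds m b) : (m.μ b : ℝ) ∈ Set.Ioo (0 : ℝ) 1 := ⟨τ.pos b, τ.lt_one⟩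

lemma w_mem (τ : Thresholds m b) {a : Fin M} (ha : a ≠ b) : (τ.w a : ℝ) ∈ Set.Ioo (0 : ℝ) 1 :=
  ⟨lt_trans (show (0 : ℝ) < m.μ a from τ.pos a) (τ.lt_w a ha),
    lt_trans (show (τ.w a : ℝ) < τ.y from τ.w_lt a ha)
      (lt_trans (show (τ.y : ℝ) < τ.x from τ.y_lt) τ.x_mem.2)⟩

lemma y_mem (τ : Thresholds m b) {a : Fin M} (ha : a ≠ b) : (τ.y : ℝ) ∈ Set.Ioo (0 : ℝ) 1 :=
  ⟨lt_trans (τ.w_mem ha).1 (τ.w_lt a ha), lt_trans (show (τ.y : ℝ) < τ.x from τ.y_lt) τ.x_mem.2⟩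

lemma μ_mem (τ : Thresholds m b) {a : Fin M} (ha : a ≠ b) : (m.μ a : ℝ) ∈ Set.Ioo (0 : ℝ) 1 :=
  ⟨τ.pos a, lt_trans (show (m.μ a : ℝ) < τ.w a from τ.lt_w a ha) (τ.w_mem ha).2⟩

end Thresholds

/-- The empirical mean of `a` deviates beyond `w` by more than the bonus allows. -/
def Exceeds (m : MABA M) (a : Fin M) (w : ℝ) (φ : History M) : Prop :=
  Deviates m a w φ ∧ bonus φ.length < pulls φ a * klReal (empMean φ a) w

variable {m : MABA M} {b : Fin M} {π : Policy M}

/-- Outside the two bad events the upper index of a is at least that of b, hence at least x > y. So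
y lies in the confidence set of a although the empirical mean is below w(a), and this forces pulls ·
kl(w(a), y) to be at most the bonus. -/
lemma armAt_of_state_true (τ : Thresholds m b) (hπ : IsKLULCB 1 1 4 π) {C : Config M} {a : Fin M}
    {t n : ℕ} (ht : C.hist.length ≤ t) (hs : C.state = true) (ha : armAt π C = a) (hab : a ≠ b)
    (hn : maxBonus t ≤ n * klReal (τ.w a) τ.y) :
    pulls C.hist a < n + 1 ∨ Exceeds m b τ.x C.hist ∨ Deviates m a (τ.w a) C.hist := by
  obtain ⟨h1, h2⟩ := hπ C.state C.hist
  by_cases h0 : ∃ a, pulls C.hist a = 0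
  · left
    have := h1 h0
    change pulls C.hist (armAt π C) = 0 at this
    rw [ha] at this
    omega
  push Not at h0
  have h2 := h2 h0 b
  change klIndex _ _ _ _ _ _ ≤ klIndex 1 1 4 C.state C.hist (armAt π C) at h2
  rw [hs, ha] at h2
  by_cases hx : klIndex 1 1 4 true C.hist b < τ.x
  · right; left
    obtain ⟨k1, k2⟩ := of_upperIndex_lt hx
    exact ⟨⟨h0 b, Or.inl ⟨k1, τ.x_lt.le⟩⟩, bonus_lt_of_notMem τ.x_mem k2⟩
  · by_cases hw : (τ.w a : ℝ) ≤ empMean C.hist a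
    · right; right
      exact ⟨h0 a, Or.inr ⟨(τ.lt_w a hab).le, hw⟩⟩
    · left
      push Not at hx hw
      have hwy : (τ.w a : ℝ) ≤ τ.y := (τ.w_lt a hab).le
      have hy := mem_confSet_of_lt_upperIndex (τ.y_mem hab) (hw.le.trans hwy)
        (lt_of_lt_of_le (show (τ.y : ℝ) < τ.x from τ.y_lt) (hx.trans h2))
      have h3 := le_of_mem_confSet (τ.y_mem hab) hy ht
      have h4 := klReal_pythagoras (empMean C.hist a).2 (τ.w_mem hab) (τ.y_mem hab)
        (Or.inl ⟨hw.le, hwy⟩)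
      have h5 := klReal_nonneg (empMean C.hist a).2 (τ.w_mem hab)
      have h6 := klReal_pos (τ.w_mem hab) (τ.y_mem hab)
        (ne_of_lt (show (τ.w a : ℝ) < τ.y from τ.w_lt a hab))
      have h7 : (pulls C.hist a : ℝ) * klReal (τ.w a) τ.y ≤ n * klReal (τ.w a) τ.y := by
        refine le_trans ?_ (h3.trans hn)
        gcongr
        linarith
      have h8 : (pulls C.hist a : ℝ) ≤ n := le_of_mul_le_mul_right h7 h6
      exact Nat.lt_succ_of_le (by exact_mod_cast h8)

/-- Unless the lower index of a exceeds w(a), that of b is below y. If the empirical mean of b is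
nevertheless above x, then y is in the confidence set of b, and b has few pulls. The free level v
lets the caller also demand enough pulls for the deviation of b to be unlikely. -/
lemma armAt_of_state_false (τ : Thresholds m b) (hπ : IsKLULCB 1 1 4 π) {C : Config M} {a : Fin M}
    {v : ℝ} (hs : C.state = false) (ha : armAt π C = a) (hab : a ≠ b)
    (hv : maxBonus C.hist.length ≤ v * klReal τ.x τ.y) :
    pulls C.hist a < 1 ∨ Exceeds m a (τ.w a) C.hist ∨
      (Deviates m b τ.x C.hist ∧ v < pulls C.hist b) ∨ (pulls C.hist b : ℝ) ≤ v := by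
  obtain ⟨h1, h2⟩ := hπ C.state C.hist
  by_cases h0 : ∃ a, pulls C.hist a = 0
  · left
    have := h1 h0
    change pulls C.hist (armAt π C) = 0 at this
    rw [ha] at this
    omega
  push Not at h0
  have h2 := h2 h0 b
  change klIndex _ _ _ _ _ _ ≤ klIndex 1 1 4 C.state C.hist (armAt π C) at h2
  rw [hs, ha] at h2
  by_cases hw : (τ.w a : ℝ) < klIndex 1 1 4 false C.hist a
  · right; left
    obtain ⟨k1, k2⟩ := of_lt_lowerIndex hw
    exact ⟨⟨h0 a, Or.inr ⟨(τ.lt_w a hab).le, k1⟩⟩, bonus_lt_of_notMem (τ.w_mem hab) k2⟩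
  · right; right
    by_cases hx : (empMean C.hist b : ℝ) ≤ τ.x
    · by_cases hv' : v < pulls C.hist b
      · left
        exact ⟨⟨h0 b, Or.inl ⟨hx, τ.x_lt.le⟩⟩, hv'⟩
      · right
        exact not_lt.1 hv'
    · right
      push Not at hx hw
      have hyx : (τ.y : ℝ) ≤ τ.x := τ.y_lt.le
      have hy := mem_confSet_of_lowerIndex_lt (τ.y_mem hab) (hyx.trans hx.le)
        (lt_of_le_of_lt (h2.trans hw) (τ.w_lt a hab))
      have h3 := le_of_mem_confSet (τ.y_mem hab) hy le_rfl
      have h4 := klReal_pythagoras (empMean C.hist b).2 τ.x_mem (τ.y_mem hab)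
        (Or.inr ⟨hyx, hx.le⟩)
      have h5 := klReal_nonneg (empMean C.hist b).2 τ.x_mem
      have h6 := klReal_pos τ.x_mem (τ.y_mem hab)
        (ne_of_gt (show (τ.y : ℝ) < τ.x from τ.y_lt))
      have h7 : (pulls C.hist b : ℝ) * klReal τ.x τ.y ≤ v * klReal τ.x τ.y := by
        refine le_trans ?_ (h3.trans hv)
        gcongr
        linarith
      exact le_of_mul_le_mul_right h7 h6

open Classical in
-- At step t, Markov's inequality for the exponential moment bounds the probability by a constant
-- times exp(-bonus t), which is summable.
lemma exists_sum_ev_exceeds_le (m : MABA M) (a : Fin M) (h0 : 0 < m.μ a) (h1 : m.μ a < 1) {w : ℝ}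
    (hw : w ∈ Set.Ioo (0 : ℝ) 1) (hne : w ≠ m.μ a) :
    ∃ R : ℝ, 0 ≤ R ∧ ∀ (π : Policy M) (z : ℕ → Bool) (T : ℕ), ∑ t ∈ Finset.range T,
      ev m π z t (fun C => if Exceeds m a w C.hist then 1 else 0) ≤ ENNReal.ofReal R := by
  have hc : 0 < klReal w (m.μ a) := klReal_pos hw ⟨h0, h1⟩ hne
  refine ⟨(devConst (klReal w (m.μ a))).toReal * ∑' t, Real.exp (-bonus t),
    mul_nonneg ENNReal.toReal_nonneg (tsum_nonneg fun _ => (Real.exp_pos _).le),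
    fun π z T => ?_⟩
  rw [ENNReal.ofReal_mul ENNReal.toReal_nonneg, ENNReal.ofReal_toReal (devConst_ne_top hc)]
  refine le_trans (Finset.sum_le_sum fun t _ => ?_)
    ((Finset.mul_sum _ _ _).symm.le.trans (mul_le_mul_right (sum_ofReal_exp_neg_bonus_le T) _))
  rw [mul_comm]
  refine le_trans (ev_mono_length (g := fun C => ENNReal.ofReal (Real.exp (-bonus t))
    * if Deviates m a w C.hist then
      ENNReal.ofReal (Real.exp (pulls C.hist a * klReal (empMean C.hist a) w
        + pulls C.hist a * (klReal w (m.μ a) / 2))) else 0) ?_) ?_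
  · intro C hC
    split_ifs with h h' h'
    · rw [← ENNReal.ofReal_mul (Real.exp_pos _).le, ← Real.exp_add, ← ENNReal.ofReal_one]
      apply ENNReal.ofReal_le_ofReal
      apply Real.one_le_exp
      have h2 := h.2
      rw [hC] at h2
      have : 0 ≤ (pulls C.hist a : ℝ) * (klReal w (m.μ a) / 2) := by positivity
      linarith
    · exact absurd h.1 h'
    · exact zero_le
    · exact zero_le
  · rw [ev_const_mul]
    gcongr
    exact ev_deviates_exp_le m π z a h0 h1 hw t

end MABA

namespace MABA

variable {M : ℕ}

/-! ### Counting along a trajectory -/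

lemma run_succ_hist (π : Policy M) (z : ℕ → Bool) (x : ℕ → Seed M) (t : ℕ) :
    ∃ r d, (run π z x (t + 1)).hist
      = ⟨(run π z x t).state, armAt π (run π z x t), r, d⟩ :: (run π z x t).hist :=
  ⟨_, _, rfl⟩

lemma sum_armAt_eq (π : Policy M) (z : ℕ → Bool) (x : ℕ → Seed M) (a : Fin M) (t : ℕ) :
    ∑ j ∈ Finset.range t, (if armAt π (run π z x j) = a then 1 else 0)
      = pulls (run π z x t).hist a := by
  induction t with
  | zero => rfl
  | succ t ih =>
    obtain ⟨r, d, h⟩ := run_succ_hist π z x t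
    rw [Finset.sum_range_succ, ih, h, pulls_cons]

lemma sum_armAt_lt_eq (π : Policy M) (z : ℕ → Bool) (x : ℕ → Seed M) (a : Fin M) (n t : ℕ) :
    ∑ j ∈ Finset.range t,
      (if armAt π (run π z x j) = a ∧ pulls (run π z x j).hist a < n then 1 else 0)
      = min (pulls (run π z x t).hist a) n := by
  induction t with
  | zero => simp [run, pulls]
  | succ t ih =>
    obtain ⟨r, d, h⟩ := run_succ_hist π z x t
    rw [Finset.sum_range_succ, ih, h, pulls_cons]
    by_cases ha : armAt π (run π z x t) = a
    · by_cases hn : pulls (run π z x t).hist a < n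
      · simp only [ha, hn, and_self, if_true]; omega
      · simp only [ha, hn, and_false, if_true, if_false]; omega
    · simp [ha]

lemma sum_state_eq (π : Policy M) (z : ℕ → Bool) (x : ℕ → Seed M) (t : ℕ) :
    ∑ j ∈ Finset.range t, (if (run π z x j).state = true then 1 else 0)
      = visits (run π z x t).hist := by
  induction t with
  | zero => rfl
  | succ t ih =>
    obtain ⟨r, d, h⟩ := run_succ_hist π z x t
    rw [Finset.sum_range_succ, ih, h, visits_cons]

lemma sum_ev_eq_lintegral (m : MABA M) (π : Policy M) (z : ℕ → Bool) (T : ℕ)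
    (f : ℕ → Config M → ℝ≥0∞) :
    ∑ t ∈ Finset.range T, ev m π z t (f t)
      = ∫⁻ x, ∑ t ∈ Finset.range T, f t (run π z x t) ∂m.seedsLaw :=
  (lintegral_finsetSum _ fun t _ => Measurable.of_discrete.comp (measurable_run π z t)).symm

lemma sum_ev_armAt_lt_le (m : MABA M) (π : Policy M) (z : ℕ → Bool) (a : Fin M) (n T : ℕ) :
    ∑ t ∈ Finset.range T, ev m π z t
      (fun C => if armAt π C = a ∧ pulls C.hist a < n then 1 else 0) ≤ n := by
  rw [sum_ev_eq_lintegral m π z T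
    (fun _ C => if armAt π C = a ∧ pulls C.hist a < n then 1 else 0)]
  refine (lintegral_mono (g := fun _ => (n : ℝ≥0∞)) fun x => ?_).trans (by simp)
  have h := (sum_armAt_lt_eq π z x a n T).le.trans (min_le_right _ _)
  have h' := Nat.cast_le (α := ℝ≥0∞).2 h
  push_cast at h'
  exact h'

variable {m : MABA M} {b : Fin M}

open Classical in
/-- In state 1 a suboptimal arm is pulled at most about `log T` times, up to the constant given by
the divergence between the thresholds. -/
lemma exists_sum_ev_state_true_le (τ : Thresholds m b) {a : Fin M} (hab : a ≠ b) :
    ∃ R : ℝ, 0 ≤ R ∧ ∀ (π : Policy M), IsKLULCB 1 1 4 π → ∀ (z : ℕ → Bool) (T : ℕ),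
      ∑ t ∈ Finset.range T, ev m π z t
        (fun C => if C.state = true ∧ armAt π C = a then 1 else 0)
        ≤ ENNReal.ofReal (maxBonus T / klReal (τ.w a) τ.y + R) := by
  obtain ⟨R, hR0, hR⟩ := exists_sum_ev_exceeds_le m b (τ.pos b) τ.lt_one τ.x_mem
    (ne_of_lt (show (τ.x : ℝ) < m.μ b from τ.x_lt))
  have hkl := klReal_pos (τ.w_mem hab) (τ.y_mem hab)
    (ne_of_lt (show (τ.w a : ℝ) < τ.y from τ.w_lt a hab))
  have hc : 0 < klReal (τ.w a) (m.μ a) := klReal_pos (τ.w_mem hab) (τ.μ_mem hab)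
    (ne_of_gt (show (m.μ a : ℝ) < τ.w a from τ.lt_w a hab))
  -- The 2 covers rounding up to n and the extra pull in n + 1.
  refine ⟨2 + R + (devConst (klReal (τ.w a) (m.μ a))).toReal, by positivity,
    fun π hπ z T => ?_⟩
  set n := ⌈maxBonus T / klReal (τ.w a) τ.y⌉₊ with hn
  have hdiv : 0 ≤ maxBonus T / klReal (τ.w a) τ.y := div_nonneg (maxBonus_nonneg T) hkl.le
  have hnT : maxBonus T ≤ n * klReal (τ.w a) τ.y := by
    rw [← div_le_iff₀ hkl]; exact Nat.le_ceil _
  have hpt : ∀ t ∈ Finset.range T, ev m π z t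
      (fun C => if C.state = true ∧ armAt π C = a then 1 else 0)
      ≤ ev m π z t (fun C => if armAt π C = a ∧ pulls C.hist a < n + 1 then 1 else 0)
        + ev m π z t (fun C => if Exceeds m b τ.x C.hist then 1 else 0)
        + ev m π z t (fun C => if armAt π C = a ∧ Deviates m a (τ.w a) C.hist then 1 else 0) := by
    intro t ht
    rw [← ev_add, ← ev_add]
    refine ev_mono_length fun C hC => ?_
    by_cases h : C.state = true ∧ armAt π C = a
    · rcases armAt_of_state_true τ hπ (hC.trans_le (Finset.mem_range.1 ht).le) h.1 h.2 hab hnT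
        with h1 | h1 | h1
      · rw [if_pos h, if_pos ⟨h.2, h1⟩]
        exact le_self_add.trans le_self_add
      · rw [if_pos h, if_pos h1]
        exact le_add_self.trans le_self_add
      · rw [if_pos h, if_pos (⟨h.2, h1⟩ : armAt π C = a ∧ Deviates m a (τ.w a) C.hist)]
        exact le_add_self
    · rw [if_neg h]
      exact zero_le
  refine (Finset.sum_le_sum hpt).trans ?_
  rw [Finset.sum_add_distrib, Finset.sum_add_distrib]
  refine (add_le_add (add_le_add (sum_ev_armAt_lt_le m π z a (n + 1) T) (hR π z T))
    (sum_ev_deviates_le m π z a (τ.pos a) (τ.μ_mem hab).2 (τ.w_mem hab) T)).trans ?_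
  rw [← ENNReal.ofReal_natCast, ← ENNReal.ofReal_toReal (devConst_ne_top hc),
    ← ENNReal.ofReal_add (by positivity) hR0,
    ← ENNReal.ofReal_add (by positivity) ENNReal.toReal_nonneg, ENNReal.toReal_ofReal
      ENNReal.toReal_nonneg]
  apply ENNReal.ofReal_le_ofReal
  have := Nat.ceil_lt_add_one hdiv
  rw [← hn] at this
  push_cast
  linarith

lemma eventually_maxBonus_le {ε : ℝ} (hε : 0 < ε) : ∀ᶠ t : ℕ in atTop, maxBonus t ≤ ε * t := by
  have h1 := (Real.isLittleO_log_id_atTop.bound (show 0 < ε / 10 by positivity))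
  have h2 : Tendsto (fun t : ℕ => (t : ℝ) + 3) atTop atTop :=
    tendsto_atTop_add_const_right _ _ tendsto_natCast_atTop_atTop
  filter_upwards [h2.eventually h1, eventually_ge_atTop 3] with t ht ht3
  have h3 : (3 : ℝ) ≤ t := by exact_mod_cast ht3
  have h4 := one_lt_log_add_three t
  rw [Real.norm_of_nonneg (by linarith), id, Real.norm_of_nonneg (by linarith)] at ht
  have := maxBonus_le t
  nlinarith

lemma sum_range_le_add_one {X : ℝ} (hX : 0 ≤ X) (T : ℕ) :
    ∑ t ∈ Finset.range T, (if (t : ℝ) ≤ X then (1 : ℝ≥0∞) else 0) ≤ ENNReal.ofReal X + 1 := by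
  rw [← Finset.sum_filter, Finset.sum_const, nsmul_one]
  have h1 : (Finset.range T).filter (fun t : ℕ => (t : ℝ) ≤ X) ⊆ Finset.range (⌊X⌋₊ + 1) := by
    intro t ht
    rw [Finset.mem_range, Nat.lt_succ_iff]
    exact Nat.le_floor (Finset.mem_filter.1 ht).2
  have h2 := Finset.card_le_card h1
  rw [Finset.card_range] at h2
  rw [← ENNReal.ofReal_one, ← ENNReal.ofReal_add hX zero_le_one, ← ENNReal.ofReal_natCast]
  apply ENNReal.ofReal_le_ofReal
  have h3 := Nat.floor_le hX
  have h4 : (((Finset.range T).filter (fun t : ℕ => (t : ℝ) ≤ X)).card : ℝ) ≤ (⌊X⌋₊ + 1 : ℕ) := by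
    exact_mod_cast h2
  push_cast at h4
  linarith

/-- Chernoff's bound: with ρ equal to half the decay rate of `exists_ev_visits_le`, the factor
exp(ρt) still leaves exp(-ρt). -/
lemma exists_sum_ev_visits_le (m : MABA M) (c : Fin M) (hc : ∀ a, m.μ c ≤ m.μ a)
    (hc0 : 0 < m.μ c) (hq : ∀ s, m.q s true < 1) :
    ∃ ρ R : ℝ, 0 < ρ ∧ 0 ≤ R ∧ ∀ (π : Policy M) (z : ℕ → Bool) (T : ℕ), ∑ t ∈ Finset.range T,
      ev m π z t (fun C => if (visits C.hist : ℝ) ≤ ρ * t then 1 else 0) ≤ ENNReal.ofReal R := by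
  obtain ⟨κ, hκ0, hκ1, hκ⟩ := exists_ev_visits_le m c hc hc0 hq
  have hρ : 0 < -Real.log κ / 2 := by
    have := Real.log_neg hκ0 hκ1
    linarith
  set ρ := -Real.log κ / 2 with hρdef
  have hr : Real.exp ρ * κ = Real.exp (-ρ) := by
    calc Real.exp ρ * κ = Real.exp ρ * Real.exp (Real.log κ) := by rw [Real.exp_log hκ0]
      _ = Real.exp (-ρ) := by
        rw [← Real.exp_add]
        congr 1
        rw [hρdef]; ring
  have hr1 : Real.exp (-ρ) < 1 := by rw [Real.exp_lt_one_iff]; linarith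
  refine ⟨ρ, ∑' t : ℕ, Real.exp 1 * Real.exp (-ρ) ^ t, hρ,
    tsum_nonneg fun t => by positivity, fun π z T => ?_⟩
  have hsum : Summable fun t : ℕ => Real.exp 1 * Real.exp (-ρ) ^ t :=
    (summable_geometric_of_lt_one (Real.exp_pos _).le hr1).mul_left _
  refine le_trans (Finset.sum_le_sum fun t _ => ?_)
    ((ENNReal.ofReal_sum_of_nonneg (s := Finset.range T)
      (f := fun t => Real.exp 1 * Real.exp (-ρ) ^ t) fun _ _ => by positivity).symm.le.trans
      (ENNReal.ofReal_le_ofReal (hsum.sum_le_tsum _ fun _ _ => by positivity)))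
  calc _ ≤ ev m π z t (fun C => ENNReal.ofReal (Real.exp (ρ * t))
        * ENNReal.ofReal (Real.exp (-(visits C.hist : ℝ)))) := by
        refine ev_mono fun C => ?_
        split_ifs with h
        · rw [← ENNReal.ofReal_mul (Real.exp_pos _).le, ← Real.exp_add, ← ENNReal.ofReal_one]
          exact ENNReal.ofReal_le_ofReal (Real.one_le_exp (by linarith))
        · exact zero_le
    _ = _ := ev_const_mul _ _ _
    _ ≤ ENNReal.ofReal (Real.exp (ρ * t)) * ENNReal.ofReal (Real.exp 1 * κ ^ t) := by
        gcongr; exact hκ π z t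
    _ = _ := by
        rw [← ENNReal.ofReal_mul (Real.exp_pos _).le, ← hr, mul_pow, ← Real.exp_nat_mul]
        congr 1
        rw [mul_comm ρ]; ring

open Classical in
/-- The number of events that make a suboptimal arm, pulled often already, look optimal. -/
noncomputable def mistakes (τ : Thresholds m b) (π : Policy M) (C : Config M) : ℕ :=
  (if Exceeds m b τ.x C.hist then 1 else 0)
    + ∑ a ∈ Finset.univ.erase b, if armAt π C = a ∧ Deviates m a (τ.w a) C.hist then 1 else 0

lemma exists_sum_ev_mistakes_le (τ : Thresholds m b) :
    ∃ R : ℝ, 0 ≤ R ∧ ∀ (π : Policy M) (z : ℕ → Bool) (T : ℕ), ∑ t ∈ Finset.range T,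
      ev m π z t (fun C => (mistakes τ π C : ℝ≥0∞)) ≤ ENNReal.ofReal R := by
  classical
  obtain ⟨R, hR0, hR⟩ := exists_sum_ev_exceeds_le m b (τ.pos b) τ.lt_one τ.x_mem
    (ne_of_lt (show (τ.x : ℝ) < m.μ b from τ.x_lt))
  refine ⟨R + ∑ a ∈ Finset.univ.erase b, (devConst (klReal (τ.w a) (m.μ a))).toReal,
    add_nonneg hR0 (Finset.sum_nonneg fun _ _ => ENNReal.toReal_nonneg), fun π z T => ?_⟩
  have e : ∀ t, ev m π z t (fun C => (mistakes τ π C : ℝ≥0∞))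
      = ev m π z t (fun C => if Exceeds m b τ.x C.hist then 1 else 0)
        + ∑ a ∈ Finset.univ.erase b,
          ev m π z t (fun C => if armAt π C = a ∧ Deviates m a (τ.w a) C.hist then 1 else 0) := by
    intro t
    rw [← ev_finset_sum, ← ev_add]
    simp [mistakes]
  simp only [e]
  rw [Finset.sum_add_distrib, Finset.sum_comm, ENNReal.ofReal_add hR0
    (Finset.sum_nonneg fun _ _ => ENNReal.toReal_nonneg),
    ENNReal.ofReal_sum_of_nonneg fun _ _ => ENNReal.toReal_nonneg]
  refine add_le_add (hR π z T) (Finset.sum_le_sum fun a ha => ?_)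
  have hab := Finset.ne_of_mem_erase ha
  have hc : 0 < klReal (τ.w a) (m.μ a) := klReal_pos (τ.w_mem hab) (τ.μ_mem hab)
    (ne_of_gt (show (m.μ a : ℝ) < τ.w a from τ.lt_w a hab))
  rw [ENNReal.ofReal_toReal (devConst_ne_top hc)]
  exact sum_ev_deviates_le m π z a (τ.pos a) (τ.μ_mem hab).2 (τ.w_mem hab) T

/-- A pathwise count: by `armAt_of_state_true`, a step in state 1 is a pull of b, a mistake, or one
of the first n + 1 pulls of some arm. -/
lemma visits_le (τ : Thresholds m b) {π : Policy M} (hπ : IsKLULCB 1 1 4 π) (z : ℕ → Bool)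
    (x : ℕ → Seed M) {t n : ℕ} (hn : ∀ a, a ≠ b → maxBonus t ≤ n * klReal (τ.w a) τ.y) :
    visits (run π z x t).hist ≤ pulls (run π z x t).hist b
      + ∑ j ∈ Finset.range t, mistakes τ π (run π z x j) + M * (n + 1) := by
  classical
  have hpt : ∀ j ∈ Finset.range t, (if (run π z x j).state = true then 1 else 0)
      ≤ (if armAt π (run π z x j) = b then 1 else 0) + mistakes τ π (run π z x j)
        + ∑ a, if armAt π (run π z x j) = a ∧ pulls (run π z x j).hist a < n + 1
          then 1 else 0 := by
    intro j hj
    set C := run π z x j with hC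
    have hlen : C.hist.length ≤ t := (run_hist_length x j).trans_le (Finset.mem_range.1 hj).le
    by_cases hs : C.state = true
    · rw [if_pos hs]
      by_cases hab : armAt π C = b
      · rw [if_pos hab]; omega
      · rcases armAt_of_state_true τ hπ hlen hs rfl hab (hn _ hab) with h | h | h
        · have := Finset.single_le_sum (f := fun a =>
            if armAt π C = a ∧ pulls C.hist a < n + 1 then 1 else 0) (fun _ _ => Nat.zero_le _)
            (Finset.mem_univ (armAt π C))
          simp only [h, and_self, if_true] at this
          omega
        · have : 1 ≤ mistakes τ π C := by
            unfold mistakes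
            rw [if_pos h]
            omega
          omega
        · have h1 := Finset.single_le_sum (f := fun a =>
            if armAt π C = a ∧ Deviates m a (τ.w a) C.hist then 1 else 0)
            (fun _ _ => Nat.zero_le _) (Finset.mem_erase.2 ⟨hab, Finset.mem_univ (armAt π C)⟩)
          simp only [h, and_self, if_true] at h1
          have : 1 ≤ mistakes τ π C := by
            unfold mistakes
            omega
          omega
    · rw [if_neg hs]; exact Nat.zero_le _
  rw [← sum_state_eq, ← sum_armAt_eq]
  refine (Finset.sum_le_sum hpt).trans ?_
  rw [Finset.sum_add_distrib, Finset.sum_add_distrib, Finset.sum_comm]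
  refine Nat.add_le_add_left ?_ _
  simp only [sum_armAt_lt_eq]
  refine (Finset.sum_le_sum fun a _ => min_le_right _ _).trans ?_
  simp

/-- The times at which the best arm has been pulled less than a multiple of `log t` times are
bounded in expectation. -/
lemma exists_sum_ev_pulls_le (τ : Thresholds m b) (c : Fin M) (hc : ∀ a, m.μ c ≤ m.μ a)
    (hq : ∀ s, m.q s true < 1) {B : ℝ} (hB : 0 ≤ B) :
    ∃ R : ℝ, 0 ≤ R ∧ ∀ (π : Policy M), IsKLULCB 1 1 4 π → ∀ (z : ℕ → Bool) (T : ℕ),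
      ∑ t ∈ Finset.range T, ev m π z t
        (fun C => if (pulls C.hist b : ℝ) ≤ B * maxBonus t then 1 else 0) ≤ ENNReal.ofReal R := by
  classical
  obtain ⟨ρ, R₁, hρ, hR₁0, hR₁⟩ := exists_sum_ev_visits_le m c hc (τ.pos c) hq
  obtain ⟨R₂, hR₂0, hR₂⟩ := exists_sum_ev_mistakes_le τ
  have hkl : ∀ a, a ≠ b → 0 < klReal (τ.w a) τ.y := fun a hab =>
    klReal_pos (τ.w_mem hab) (τ.y_mem hab) (ne_of_lt (show (τ.w a : ℝ) < τ.y from τ.w_lt a hab))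
  set D := ∑ a ∈ Finset.univ.erase b, (klReal (τ.w a) τ.y)⁻¹ with hD
  have hD0 : 0 ≤ D := Finset.sum_nonneg fun a ha =>
    (inv_pos.2 (hkl a (Finset.ne_of_mem_erase ha))).le
  have hDle : ∀ a, a ≠ b → (klReal (τ.w a) τ.y)⁻¹ ≤ D := fun a hab =>
    Finset.single_le_sum (f := fun a => (klReal (τ.w a) τ.y)⁻¹)
      (fun a ha => (inv_pos.2 (hkl a (Finset.ne_of_mem_erase ha))).le)
      (Finset.mem_erase.2 ⟨hab, Finset.mem_univ a⟩)
  -- Beyond t₀ all the logarithmic terms together use at most half of the ρt visits.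
  obtain ⟨t₀, ht₀⟩ : ∃ t₀ : ℕ, ∀ t ≥ t₀,
      B * maxBonus t + M * (D * maxBonus t + 2) ≤ ρ / 2 * t := by
    have h1 := eventually_maxBonus_le (show 0 < ρ / (4 * (B + M * D + 1)) by positivity)
    have h2 : ∀ᶠ t : ℕ in atTop, M * 2 ≤ ρ / 4 * (t : ℝ) :=
      (tendsto_natCast_atTop_atTop.const_mul_atTop (show 0 < ρ / 4 by positivity)).eventually_ge_atTop _
    obtain ⟨t₀, h⟩ := eventually_atTop.1 (h1.and h2)
    refine ⟨t₀, fun t ht => ?_⟩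
    obtain ⟨h1, h2⟩ := h t ht
    have h3 : (B + M * D) * maxBonus t ≤ ρ / 4 * t := by
      calc _ ≤ (B + M * D + 1) * maxBonus t :=
            mul_le_mul_of_nonneg_right (by linarith) (maxBonus_nonneg t)
        _ ≤ (B + M * D + 1) * (ρ / (4 * (B + M * D + 1)) * t) := by gcongr
        _ = _ := by field_simp
    linarith
  refine ⟨t₀ + 1 + R₁ + 2 / ρ * R₂, by positivity, fun π hπ z T => ?_⟩
  have hpt : ∀ x : ℕ → Seed M, ∑ t ∈ Finset.range T,
      (if (pulls (run π z x t).hist b : ℝ) ≤ B * maxBonus t then (1 : ℝ≥0∞) else 0)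
      ≤ (t₀ + 1) + (∑ t ∈ Finset.range T,
          if (visits (run π z x t).hist : ℝ) ≤ ρ * t then 1 else 0)
        + ENNReal.ofReal (2 / ρ) * ∑ t ∈ Finset.range T, (mistakes τ π (run π z x t) : ℝ≥0∞) := by
    intro x
    -- If t ≥ t₀, state 1 has been visited more than ρt times and b has few pulls, then mistakes
    -- must account for more than ρt/2 of the visits. So t ≤ 2W/ρ, and at most 2W/ρ + 1 such times
    -- exist; W has bounded expectation.
    set W : ℕ := ∑ t ∈ Finset.range T, mistakes τ π (run π z x t) with hW
    have hone : ∀ t ∈ Finset.range T,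
        (if (pulls (run π z x t).hist b : ℝ) ≤ B * maxBonus t then (1 : ℝ≥0∞) else 0)
        ≤ (if t < t₀ then 1 else 0) + (if (visits (run π z x t).hist : ℝ) ≤ ρ * t then 1 else 0)
          + (if (t : ℝ) ≤ 2 / ρ * W then 1 else 0) := by
      intro t ht
      by_cases h1 : t < t₀
      · rw [if_pos h1, add_assoc]
        refine le_trans ?_ le_self_add
        split_ifs <;> simp
      by_cases h2 : (visits (run π z x t).hist : ℝ) ≤ ρ * t
      · rw [if_pos h2, add_right_comm]
        refine le_trans ?_ le_add_self
        split_ifs <;> simp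
      by_cases h3 : (t : ℝ) ≤ 2 / ρ * W
      · rw [if_pos h3]
        refine le_trans ?_ le_add_self
        split_ifs <;> simp
      rw [if_neg]
      · exact zero_le
      intro h4
      have hn : ∀ a, a ≠ b → maxBonus t ≤ (⌈D * maxBonus t⌉₊ : ℕ) * klReal (τ.w a) τ.y := by
        intro a hab
        have h5 := mul_le_mul_of_nonneg_right (hDle a hab) (maxBonus_nonneg t)
        have h6 := h5.trans (Nat.le_ceil _)
        rwa [inv_mul_le_iff₀ (hkl a hab), mul_comm] at h6
      have hv := visits_le τ hπ z x hn
      have hWt : ∑ j ∈ Finset.range t, mistakes τ π (run π z x j) ≤ W :=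
        Finset.sum_le_sum_of_subset (Finset.range_mono (Finset.mem_range.1 ht).le)
      have hv' : (visits (run π z x t).hist : ℝ) ≤ pulls (run π z x t).hist b + W
          + M * ((⌈D * maxBonus t⌉₊ : ℕ) + 1) := by
        have : visits (run π z x t).hist ≤ pulls (run π z x t).hist b + W
          + M * (⌈D * maxBonus t⌉₊ + 1) := by omega
        exact_mod_cast this
      have hceil := Nat.ceil_lt_add_one (mul_nonneg hD0 (maxBonus_nonneg t))
      have hceil' : (M : ℝ) * ((⌈D * maxBonus t⌉₊ : ℕ) + 1) ≤ M * (D * maxBonus t + 2) :=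
        mul_le_mul_of_nonneg_left (by linarith) (Nat.cast_nonneg M)
      have h7 := ht₀ t (not_lt.1 h1)
      have h8 : ρ / 2 * t < W := by linarith [not_le.1 h2]
      apply h3
      rw [div_mul_eq_mul_div, le_div_iff₀ hρ]
      linarith
    refine (Finset.sum_le_sum hone).trans ?_
    rw [Finset.sum_add_distrib, Finset.sum_add_distrib]
    have k1 : ∑ t ∈ Finset.range T, (if t < t₀ then (1 : ℝ≥0∞) else 0) ≤ t₀ := by
      rw [← Finset.sum_filter, Finset.sum_const, nsmul_one]
      have : (Finset.range T).filter (· < t₀) ⊆ Finset.range t₀ := by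
        intro t ht
        exact Finset.mem_range.2 (Finset.mem_filter.1 ht).2
      have := Finset.card_le_card this
      rw [Finset.card_range] at this
      exact_mod_cast this
    have k2 := sum_range_le_add_one (show 0 ≤ 2 / ρ * (W : ℝ) by positivity) T
    have k3 : ENNReal.ofReal (2 / ρ * (W : ℝ)) = ENNReal.ofReal (2 / ρ)
        * ∑ t ∈ Finset.range T, (mistakes τ π (run π z x t) : ℝ≥0∞) := by
      rw [ENNReal.ofReal_mul (by positivity), ENNReal.ofReal_natCast, hW, Nat.cast_sum]
    rw [k3] at k2
    refine (add_le_add (add_le_add k1 le_rfl) k2).trans (le_of_eq ?_)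
    ring
  rw [sum_ev_eq_lintegral m π z T
    (fun t C => if (pulls C.hist b : ℝ) ≤ B * maxBonus t then 1 else 0)]
  refine (lintegral_mono hpt).trans ?_
  have hm1 : Measurable fun x => ∑ t ∈ Finset.range T, (mistakes τ π (run π z x t) : ℝ≥0∞) :=
    Finset.measurable_sum _ fun t _ =>
      (Measurable.of_discrete (f := fun C => (mistakes τ π C : ℝ≥0∞))).comp (measurable_run π z t)
  rw [lintegral_add_right _ (hm1.const_mul _), lintegral_add_left measurable_const,
    lintegral_const_mul _ hm1,
    ← sum_ev_eq_lintegral m π z T (fun t C => if (visits C.hist : ℝ) ≤ ρ * t then 1 else 0),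
    ← sum_ev_eq_lintegral m π z T (fun t C => (mistakes τ π C : ℝ≥0∞))]
  rw [ENNReal.ofReal_add (by positivity) (by positivity), ENNReal.ofReal_add (by positivity) hR₁0,
    ENNReal.ofReal_mul (by positivity)]
  refine add_le_add (add_le_add ?_ (hR₁ π z T)) (by gcongr; exact hR₂ π z T)
  simp [ENNReal.ofReal_add]

open Classical in
/-- In state 0 the suboptimal arms are pulled a bounded number of times in expectation. -/
lemma exists_sum_ev_state_false_le (τ : Thresholds m b) (c : Fin M) (hc : ∀ a, m.μ c ≤ m.μ a)
    (hq : ∀ s, m.q s true < 1) {a : Fin M} (hab : a ≠ b) :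
    ∃ R : ℝ, 0 ≤ R ∧ ∀ (π : Policy M), IsKLULCB 1 1 4 π → ∀ (z : ℕ → Bool) (T : ℕ),
      ∑ t ∈ Finset.range T, ev m π z t
        (fun C => if C.state = false ∧ armAt π C = a then 1 else 0) ≤ ENNReal.ofReal R := by
  have hcb : 0 < klReal τ.x (m.μ b) := klReal_pos τ.x_mem τ.μb_mem
    (ne_of_lt (show (τ.x : ℝ) < m.μ b from τ.x_lt))
  have hxy : 0 < klReal τ.x τ.y := klReal_pos τ.x_mem (τ.y_mem hab)
    (ne_of_gt (show (τ.y : ℝ) < τ.x from τ.y_lt))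
  -- The first summand meets the requirement of `armAt_of_state_false`. The second makes more than B
  -- · `maxBonus t` pulls push the half surplus of `ev_deviates_exp_le` above the bonus.
  set B : ℝ := (klReal τ.x τ.y)⁻¹ + 2 / klReal τ.x (m.μ b) with hB
  have hB0 : 0 ≤ B := by positivity
  obtain ⟨R₁, hR₁0, hR₁⟩ := exists_sum_ev_exceeds_le m a (τ.pos a) (τ.μ_mem hab).2 (τ.w_mem hab)
    (ne_of_gt (show (m.μ a : ℝ) < τ.w a from τ.lt_w a hab))
  obtain ⟨R₂, hR₂0, hR₂⟩ := exists_sum_ev_pulls_le τ c hc hq hB0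
  set R₃ : ℝ := (devConst (klReal τ.x (m.μ b))).toReal * ∑' t, Real.exp (-bonus t) with hR₃
  have hR₃0 : 0 ≤ R₃ := mul_nonneg ENNReal.toReal_nonneg (tsum_nonneg fun _ => (Real.exp_pos _).le)
  refine ⟨1 + R₁ + R₃ + R₂, by positivity, fun π hπ z T => ?_⟩
  have hpt : ∀ t ∈ Finset.range T, ev m π z t
      (fun C => if C.state = false ∧ armAt π C = a then 1 else 0)
      ≤ ev m π z t (fun C => if armAt π C = a ∧ pulls C.hist a < 1 then 1 else 0)
        + ev m π z t (fun C => if Exceeds m a (τ.w a) C.hist then 1 else 0)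
        + ev m π z t (fun C => if Deviates m b τ.x C.hist ∧ B * maxBonus t < pulls C.hist b
            then 1 else 0)
        + ev m π z t (fun C => if (pulls C.hist b : ℝ) ≤ B * maxBonus t then 1 else 0) := by
    intro t ht
    rw [← ev_add, ← ev_add, ← ev_add]
    refine ev_mono_length fun C hC => ?_
    by_cases h : C.state = false ∧ armAt π C = a
    · have hv : maxBonus C.hist.length ≤ B * maxBonus t * klReal τ.x τ.y := by
        have h0 := maxBonus_nonneg t
        have h1 : (klReal τ.x τ.y)⁻¹ * maxBonus t * klReal τ.x τ.y = maxBonus t := by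
          field_simp
        have h2 : 0 ≤ 2 / klReal τ.x (m.μ b) * maxBonus t * klReal τ.x τ.y := by positivity
        rw [hC, hB]
        linarith
      rcases armAt_of_state_false τ hπ h.1 h.2 hab hv with h1 | h1 | h1 | h1
      · rw [if_pos h, if_pos ⟨h.2, h1⟩]
        exact le_self_add.trans (le_self_add.trans le_self_add)
      · rw [if_pos h, if_pos h1]
        exact le_add_self.trans (le_self_add.trans le_self_add)
      · rw [if_pos h, if_pos h1]
        exact le_add_self.trans le_self_add
      · rw [if_pos h, if_pos h1]
        exact le_add_self
    · rw [if_neg h]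
      exact zero_le
  have hdev : ∑ t ∈ Finset.range T, ev m π z t (fun C =>
      if Deviates m b τ.x C.hist ∧ B * maxBonus t < pulls C.hist b then 1 else 0)
      ≤ ENNReal.ofReal R₃ := by
    rw [hR₃, ENNReal.ofReal_mul ENNReal.toReal_nonneg, ENNReal.ofReal_toReal (devConst_ne_top hcb)]
    refine le_trans (Finset.sum_le_sum fun t _ => ?_)
      ((Finset.mul_sum _ _ _).symm.le.trans (mul_le_mul_right (sum_ofReal_exp_neg_bonus_le T) _))
    rw [mul_comm (devConst _)]
    refine le_trans (ev_mono (g := fun C => ENNReal.ofReal (Real.exp (-bonus t))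
      * if Deviates m b τ.x C.hist then
        ENNReal.ofReal (Real.exp (pulls C.hist b * klReal (empMean C.hist b) τ.x
          + pulls C.hist b * (klReal τ.x (m.μ b) / 2))) else 0) ?_) ?_
    · intro C
      by_cases h : Deviates m b τ.x C.hist ∧ B * maxBonus t < pulls C.hist b
      · rw [if_pos h, if_pos h.1, ← ENNReal.ofReal_mul (Real.exp_pos _).le, ← Real.exp_add,
          ← ENNReal.ofReal_one]
        apply ENNReal.ofReal_le_ofReal
        apply Real.one_le_exp
        have h1 := klReal_nonneg (empMean C.hist b).2 τ.x_mem
        have h2 : 0 ≤ (pulls C.hist b : ℝ) * klReal (empMean C.hist b) τ.x := by positivity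
        have h3 : bonus t ≤ pulls C.hist b * (klReal τ.x (m.μ b) / 2) := by
          have h0 := maxBonus_nonneg t
          calc bonus t ≤ maxBonus t := bonus_le_maxBonus le_rfl
            _ = 2 / klReal τ.x (m.μ b) * maxBonus t * (klReal τ.x (m.μ b) / 2) := by field_simp
            _ ≤ B * maxBonus t * (klReal τ.x (m.μ b) / 2) := by
                gcongr
                rw [hB]
                linarith [inv_pos.2 hxy]
            _ ≤ _ := by gcongr; exact h.2.le
        linarith
      · rw [if_neg h]
        exact zero_le
    · rw [ev_const_mul]
      gcongr
      exact ev_deviates_exp_le m π z b (τ.pos b) τ.lt_one τ.x_mem t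
  refine (Finset.sum_le_sum hpt).trans ?_
  rw [Finset.sum_add_distrib, Finset.sum_add_distrib, Finset.sum_add_distrib,
    ENNReal.ofReal_add (by positivity) hR₂0, ENNReal.ofReal_add (by positivity) hR₃0,
    ENNReal.ofReal_add zero_le_one hR₁0]
  refine add_le_add (add_le_add (add_le_add ?_ (hR₁ π z T)) hdev) (hR₂ π hπ z T)
  simpa using sum_ev_armAt_lt_le m π z a 1 T

end MABA

namespace MABA

variable {M : ℕ}

/-! ### Asymptotics of the regret -/

variable {m : MABA M} {b : Fin M}

/-- Before time A(K + 1) the pull counts in the two states apply; afterwards the probability that K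
episodes are still running is summable with a bound independent of K. -/
lemma exists_tsum_ev_gap_le (τ : Thresholds m b) (c : Fin M) (hc : ∀ a, m.μ c ≤ m.μ a)
    (hb : ∀ a, m.μ a ≤ m.μ b) (hq : ∀ s, m.q s true < 1) (hq00 : 0 < m.q false false) :
    ∃ (A : ℕ) (R : ℝ), 0 < A ∧ 0 ≤ R ∧ ∀ (π : Policy M), IsKLULCB 1 1 4 π → ∀ (z : ℕ → Bool) (K : ℕ),
      ∑' t, ev m π z t (fun C => live K C * m.gap b C.state (armAt π C)) ≤ ENNReal.ofReal
        (∑ a ∈ Finset.univ.erase b, (m.gap b true a).toReal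
          * (maxBonus (A * (K + 1)) / klReal (τ.w a) τ.y) + R) := by
  classical
  obtain ⟨κ, hκ0, hκ1, hκ⟩ := exists_ev_live_le m b hb τ.lt_one hq00
  -- With κ^A < 1/2, the factor 2^(K + 1) of `exists_ev_live_le` is cancelled at time A(K + 1).
  obtain ⟨A, hA⟩ := exists_pow_lt_of_lt_one (show (0 : ℝ) < 1 / 2 by norm_num) hκ1
  have hfin : ∀ s, m.VE b s ≠ ∞ := m.VE_ne_top b τ.lt_one hq00
  have hgfin : ∀ s a, m.gap b s a ≠ ∞ := fun s a => ENNReal.sub_ne_top (hfin s)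
  have hgbb : ∀ s, m.gap b s b = 0 := by
    intro s
    unfold gap
    rw [← VE_eq_bellman, tsub_self]
  have h1 : ∀ a, ∃ R : ℝ, a ≠ b → 0 ≤ R ∧ ∀ (π : Policy M), IsKLULCB 1 1 4 π →
      ∀ (z : ℕ → Bool) (T : ℕ), ∑ t ∈ Finset.range T, ev m π z t
        (fun C => if C.state = true ∧ armAt π C = a then 1 else 0)
        ≤ ENNReal.ofReal (maxBonus T / klReal (τ.w a) τ.y + R) := by
    intro a
    by_cases hab : a = b
    · exact ⟨0, fun h => absurd hab h⟩
    · obtain ⟨R, hR⟩ := exists_sum_ev_state_true_le τ hab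
      exact ⟨R, fun _ => hR⟩
  have h0 : ∀ a, ∃ R : ℝ, a ≠ b → 0 ≤ R ∧ ∀ (π : Policy M), IsKLULCB 1 1 4 π →
      ∀ (z : ℕ → Bool) (T : ℕ), ∑ t ∈ Finset.range T, ev m π z t
        (fun C => if C.state = false ∧ armAt π C = a then 1 else 0) ≤ ENNReal.ofReal R := by
    intro a
    by_cases hab : a = b
    · exact ⟨0, fun h => absurd hab h⟩
    · obtain ⟨R, hR⟩ := exists_sum_ev_state_false_le τ c hc hq hab
      exact ⟨R, fun _ => hR⟩
  choose R₁ hR₁ using h1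
  choose R₀ hR₀ using h0
  have hkl : ∀ a, a ≠ b → 0 < klReal (τ.w a) τ.y := fun a hab =>
    klReal_pos (τ.w_mem hab) (τ.y_mem hab) (ne_of_lt (show (τ.w a : ℝ) < τ.y from τ.w_lt a hab))
  set G : ℝ≥0∞ := m.VE b true + m.VE b false with hG
  have hGfin : G ≠ ∞ := ENNReal.add_ne_top.2 ⟨hfin _, hfin _⟩
  have hgG : ∀ s a, m.gap b s a ≤ G := by
    intro s a
    refine tsub_le_self.trans ?_
    cases s
    · exact le_add_self
    · exact le_self_add
  set R : ℝ := ∑ a ∈ Finset.univ.erase b,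
    ((m.gap b true a).toReal * R₁ a + (m.gap b false a).toReal * R₀ a) with hR
  have hR0 : 0 ≤ R := Finset.sum_nonneg fun a ha => by
    have hab := Finset.ne_of_mem_erase ha
    exact add_nonneg (mul_nonneg ENNReal.toReal_nonneg (hR₁ a hab).1)
      (mul_nonneg ENNReal.toReal_nonneg (hR₀ a hab).1)
  have htail0 : 0 ≤ G.toReal * ∑' t : ℕ, κ ^ t :=
    mul_nonneg ENNReal.toReal_nonneg (tsum_nonneg fun t => by positivity)
  have hA0 : 0 < A := by
    rcases Nat.eq_zero_or_pos A with rfl | h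
    · norm_num at hA
    · exact h
  refine ⟨A, R + G.toReal * ∑' t : ℕ, κ ^ t, hA0, by positivity, fun π hπ z K => ?_⟩
  set T := A * (K + 1) with hT
  rw [← Summable.sum_add_tsum_nat_add' (k := T) ENNReal.summable]
  have hhead : ∑ t ∈ Finset.range T, ev m π z t
      (fun C => live K C * m.gap b C.state (armAt π C))
      ≤ ENNReal.ofReal (∑ a ∈ Finset.univ.erase b, (m.gap b true a).toReal
          * (maxBonus T / klReal (τ.w a) τ.y) + R) := by
    have hpt : ∀ C : Config M, live K C * m.gap b C.state (armAt π C)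
        ≤ ∑ a ∈ Finset.univ.erase b,
          (m.gap b true a * (if C.state = true ∧ armAt π C = a then 1 else 0)
            + m.gap b false a * (if C.state = false ∧ armAt π C = a then 1 else 0)) := by
      intro C
      have hl : live K C ≤ 1 := by unfold live; split_ifs <;> simp
      refine (mul_le_of_le_one_left' hl).trans ?_
      by_cases hab : armAt π C = b
      · rw [hab, hgbb]; exact zero_le
      · refine le_trans ?_ (Finset.single_le_sum (fun _ _ => zero_le)
          (Finset.mem_erase.2 ⟨hab, Finset.mem_univ (armAt π C)⟩))
        cases C.state <;> simp
    calc _ ≤ ∑ t ∈ Finset.range T, ∑ a ∈ Finset.univ.erase b,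
          (m.gap b true a * ev m π z t
              (fun C => if C.state = true ∧ armAt π C = a then 1 else 0)
            + m.gap b false a * ev m π z t
              (fun C => if C.state = false ∧ armAt π C = a then 1 else 0)) := by
          refine Finset.sum_le_sum fun t _ => (ev_mono hpt).trans ?_
          rw [ev_finset_sum]
          refine Finset.sum_le_sum fun a _ => ?_
          rw [ev_add, ev_const_mul, ev_const_mul]
      _ = ∑ a ∈ Finset.univ.erase b,
          (m.gap b true a * ∑ t ∈ Finset.range T, ev m π z t
              (fun C => if C.state = true ∧ armAt π C = a then 1 else 0)
            + m.gap b false a * ∑ t ∈ Finset.range T, ev m π z t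
              (fun C => if C.state = false ∧ armAt π C = a then 1 else 0)) := by
          rw [Finset.sum_comm]
          simp only [Finset.sum_add_distrib, Finset.mul_sum]
      _ ≤ ∑ a ∈ Finset.univ.erase b, ENNReal.ofReal
          ((m.gap b true a).toReal * (maxBonus T / klReal (τ.w a) τ.y)
            + ((m.gap b true a).toReal * R₁ a + (m.gap b false a).toReal * R₀ a)) := by
          refine Finset.sum_le_sum fun a ha => ?_
          have hab := Finset.ne_of_mem_erase ha
          have k1 := (hR₁ a hab).1
          have k0 := (hR₀ a hab).1
          have k2 := maxBonus_nonneg T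
          have k3 := hkl a hab
          rw [← add_assoc, ← mul_add, ENNReal.ofReal_add (by positivity) (by positivity),
            ENNReal.ofReal_mul ENNReal.toReal_nonneg, ENNReal.ofReal_mul ENNReal.toReal_nonneg,
            ENNReal.ofReal_toReal (hgfin _ _), ENNReal.ofReal_toReal (hgfin _ _)]
          gcongr
          · exact (hR₁ a hab).2 π hπ z T
          · exact (hR₀ a hab).2 π hπ z T
      _ = _ := by
          rw [← ENNReal.ofReal_sum_of_nonneg, Finset.sum_add_distrib]
          intro a ha
          have hab := Finset.ne_of_mem_erase ha
          have k1 := (hR₁ a hab).1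
          have k0 := (hR₀ a hab).1
          have k2 := maxBonus_nonneg T
          have k3 := hkl a hab
          positivity
  have htail : ∑' t, ev m π z (t + T) (fun C => live K C * m.gap b C.state (armAt π C))
      ≤ ENNReal.ofReal (G.toReal * ∑' t : ℕ, κ ^ t) := by
    rw [ENNReal.ofReal_mul ENNReal.toReal_nonneg, ENNReal.ofReal_toReal hGfin,
      ENNReal.ofReal_tsum_of_nonneg (fun t => by positivity)
        (summable_geometric_of_lt_one hκ0 hκ1), ← ENNReal.tsum_mul_left]
    refine ENNReal.tsum_le_tsum fun t => ?_
    calc _ ≤ ev m π z (t + T) (fun C => G * live K C) := ev_mono fun C => by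
          rw [mul_comm]
          gcongr
          exact hgG _ _
      _ = G * ev m π z (t + T) (live K) := ev_const_mul _ _ _
      _ ≤ G * ENNReal.ofReal (κ ^ (t + T) * 2 ^ (K + 1)) := by gcongr; exact hκ π z K (t + T)
      _ ≤ _ := by
          gcongr
          have : κ ^ T * 2 ^ (K + 1) ≤ 1 := by
            rw [hT, pow_mul, ← mul_pow]
            exact pow_le_one₀ (by positivity) (by linarith)
          calc κ ^ (t + T) * 2 ^ (K + 1) = κ ^ t * (κ ^ T * 2 ^ (K + 1)) := by ring
            _ ≤ κ ^ t * 1 := by gcongr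
            _ = _ := mul_one _
  refine (add_le_add hhead htail).trans (le_of_eq ?_)
  rw [← ENNReal.ofReal_add _ htail0, add_assoc]
  refine add_nonneg (Finset.sum_nonneg fun a ha => ?_) hR0
  have k2 := maxBonus_nonneg T
  have k3 := hkl a (Finset.ne_of_mem_erase ha)
  positivity

/-- Rescaling K changes its logarithm by O(1), and the double logarithm is negligible; so the
leading coefficient 1 of the bonus is all that survives. -/
lemma tendsto_maxBonus_div_log {A : ℕ} (hA : 0 < A) :
    Tendsto (fun K : ℕ => maxBonus (A * (K + 1)) / Real.log K) atTop (nhds 1) := by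
  set u : ℕ → ℝ := fun K => Real.log (((A * (K + 1) : ℕ) : ℝ) + 3) with hu
  have hlog : Tendsto (fun K : ℕ => Real.log K) atTop atTop :=
    Real.tendsto_log_atTop.comp tendsto_natCast_atTop_atTop
  have hle : ∀ᶠ K : ℕ in atTop, Real.log K ≤ u K := by
    filter_upwards [eventually_ge_atTop 1] with K hK
    have hK' : (0 : ℝ) < K := by exact_mod_cast hK
    refine Real.log_le_log hK' ?_
    have : K ≤ A * (K + 1) := by nlinarith
    have : (K : ℝ) ≤ ((A * (K + 1) : ℕ) : ℝ) := by exact_mod_cast this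
    linarith
  have hge : ∀ᶠ K : ℕ in atTop, u K ≤ Real.log K + Real.log (2 * A + 3) := by
    filter_upwards [eventually_ge_atTop 1] with K hK
    have hK' : (1 : ℝ) ≤ K := by exact_mod_cast hK
    have hA' : (0 : ℝ) ≤ A := Nat.cast_nonneg A
    rw [← Real.log_mul (by positivity) (by positivity)]
    refine Real.log_le_log (by positivity) ?_
    push_cast
    nlinarith
  have hpos : ∀ᶠ K : ℕ in atTop, 0 < Real.log K := hlog.eventually_gt_atTop 0
  have h1 : Tendsto (fun K => u K / Real.log K) atTop (nhds 1) := by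
    have hr : Tendsto (fun K : ℕ => 1 + Real.log (2 * A + 3) / Real.log K) atTop (nhds (1 + 0)) :=
      tendsto_const_nhds.add (hlog.const_div_atTop _)
    rw [add_zero] at hr
    refine tendsto_of_tendsto_of_tendsto_of_le_of_le' tendsto_const_nhds hr ?_ ?_
    · filter_upwards [hle, hpos] with K h hp
      rwa [le_div_iff₀ hp, one_mul]
    · filter_upwards [hge, hpos] with K h hp
      rw [div_le_iff₀ hp, add_mul, one_mul, div_mul_cancel₀ _ hp.ne']
      exact h
  have hu_top : Tendsto u atTop atTop := tendsto_atTop_mono' _ hle hlog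
  have h2 : Tendsto (fun K => Real.log (u K) / u K) atTop (nhds 0) :=
    Real.isLittleO_log_id_atTop.tendsto_div_nhds_zero.comp hu_top
  have h3 := h1.add ((h2.mul h1).const_mul 4)
  simp only [zero_mul, mul_zero, add_zero] at h3
  refine h3.congr' ?_
  filter_upwards [hu_top.eventually_gt_atTop 0] with K hK
  have : maxBonus (A * (K + 1)) = u K + 4 * Real.log (u K) := rfl
  rw [this]
  field_simp

lemma limsup_regret_le_of_thresholds (τ : Thresholds m b) (c : Fin M) (hc : ∀ a, m.μ c ≤ m.μ a)
    (hb : ∀ a, m.μ a ≤ m.μ b) (hq : ∀ s, m.q s true < 1) (hq00 : 0 < m.q false false)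
    (hle : ∀ s a, m.bellman (m.VE b) s a ≤ m.VE b s) (ν : Measure (ℕ → Bool))
    [IsProbabilityMeasure ν] (π : Policy M) (hπ : IsKLULCB 1 1 4 π) :
    limsup (fun K : ℕ => ((m.regret ν b π K / Real.log K : ℝ) : EReal)) atTop
      ≤ ((∑ a ∈ Finset.univ.erase b, (m.gap b true a).toReal / klReal (τ.w a) τ.y : ℝ) :
        EReal) := by
  obtain ⟨A, R, hA, hR0, hbound⟩ := exists_tsum_ev_gap_le τ c hc hb hq hq00
  set S := ∑ a ∈ Finset.univ.erase b, (m.gap b true a).toReal / klReal (τ.w a) τ.y with hS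
  have hS0 : 0 ≤ S := Finset.sum_nonneg fun a ha => by
    have hab := Finset.ne_of_mem_erase ha
    have := klReal_pos (τ.w_mem hab) (τ.y_mem hab)
      (ne_of_lt (show (τ.w a : ℝ) < τ.y from τ.w_lt a hab))
    positivity
  have hreg : ∀ K : ℕ, m.regret ν b π K ≤ S * maxBonus (A * (K + 1)) + R := by
    intro K
    refine (regret_le m b hb τ.lt_one hq00 hle ν π K).2 _
      (add_nonneg (mul_nonneg hS0 (maxBonus_nonneg _)) hR0) fun z => ?_
    refine (hbound π hπ z K).trans (le_of_eq ?_)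
    congr 2
    rw [hS, Finset.sum_mul]
    exact Finset.sum_congr rfl fun a _ => by ring
  have hlog : Tendsto (fun K : ℕ => Real.log K) atTop atTop :=
    Real.tendsto_log_atTop.comp tendsto_natCast_atTop_atTop
  have hlim : Tendsto (fun K : ℕ => (S * maxBonus (A * (K + 1)) + R) / Real.log K) atTop
      (nhds S) := by
    have h := ((tendsto_maxBonus_div_log hA).const_mul S).add (hlog.const_div_atTop R)
    simp only [mul_one, add_zero] at h
    refine h.congr fun K => ?_
    ring
  have hlim' := (continuous_coe_real_ereal.tendsto S).comp hlim
  rw [← hlim'.limsup_eq]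
  refine limsup_le_limsup ?_
  filter_upwards [hlog.eventually_gt_atTop 0] with K hK
  exact EReal.coe_le_coe_iff.2 (div_le_div_of_nonneg_right (hreg K) hK.le)

/-- The left side does not depend on the thresholds, so they may tend to the true means; the bound
follows by continuity of the divergence at interior points. -/
lemma limsup_regret_le (b a' c : Fin M) (hc : ∀ a, m.μ c ≤ m.μ a) (hc0 : 0 < m.μ c)
    (hb : ∀ a, a ≠ b → m.μ a ≤ m.μ a') (hb' : m.μ a' < m.μ b) (hb1 : m.μ b < 1)
    (hq : ∀ s, m.q s true < 1) (hq00 : 0 < m.q false false)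
    (hle : ∀ s a, m.bellman (m.VE b) s a ≤ m.VE b s) (ν : Measure (ℕ → Bool))
    [IsProbabilityMeasure ν] (π : Policy M) (hπ : IsKLULCB 1 1 4 π) :
    limsup (fun K : ℕ => ((m.regret ν b π K / Real.log K : ℝ) : EReal)) atTop
      ≤ ((∑ a ∈ Finset.univ.erase b, (m.gap b true a).toReal / klReal (m.μ a) (m.μ b) : ℝ) :
        EReal) := by
  have hb1' : (m.μ b : ℝ) < 1 := hb1
  have hpos : ∀ a, (0 : ℝ) < m.μ a := fun a => lt_of_lt_of_le (show (0 : ℝ) < m.μ c from hc0) (hc a)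
  obtain ⟨d, hd⟩ : ∃ d : ℝ, d = m.μ b - m.μ a' := ⟨_, rfl⟩
  have hd0 : 0 < d := by rw [hd]; exact sub_pos.2 hb'
  have ha' : ∀ a, a ≠ b → (m.μ a : ℝ) ≤ m.μ b - d := by
    intro a ha
    have : (m.μ a : ℝ) ≤ m.μ a' := hb a ha
    linarith
  have hd1 : d < m.μ b := by rw [hd]; linarith [hpos a']
  have hball : ∀ a, m.μ a ≤ m.μ b := by
    intro a
    by_cases h : a = b
    · rw [h]
    · exact (hb a h).trans hb'.le
  have hsmall : ∀ s ∈ Set.Ioo (0 : ℝ) 1,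
      limsup (fun K : ℕ => ((m.regret ν b π K / Real.log K : ℝ) : EReal)) atTop
        ≤ ((∑ a ∈ Finset.univ.erase b, (m.gap b true a).toReal
          / klReal (m.μ a + s * d / 4) (m.μ b - s * d / 2) : ℝ) : EReal) := by
    intro s hs
    have hsd0 : 0 < s * d := mul_pos hs.1 hd0
    have hsd1 : s * d < d := by nlinarith [hs.2]
    have hmem : ∀ a, a ≠ b → (m.μ a : ℝ) + s * d / 4 ∈ Set.Icc (0 : ℝ) 1 := by
      intro a ha
      have h1 := hpos a
      have h2 := ha' a ha
      constructor <;> linarith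
    -- Every suboptimal mean is at least d below the best one, and the margins sd/4 and sd/2 add up
    -- to less than d, so the thresholds are in order. The value of w at b is a dummy.
    let τ : Thresholds m b :=
      { w := fun a => if h : a = b then 0 else ⟨m.μ a + s * d / 4, hmem a h⟩
        y := ⟨m.μ b - s * d / 2, by linarith, by linarith⟩
        x := ⟨m.μ b - s * d / 4, by linarith, by linarith⟩
        pos := hpos
        lt_w := by
          intro a ha
          rw [dif_neg ha]
          show (m.μ a : ℝ) < m.μ a + s * d / 4
          linarith
        w_lt := by
          intro a ha
          rw [dif_neg ha]
          show (m.μ a : ℝ) + s * d / 4 < m.μ b - s * d / 2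
          linarith [ha' a ha]
        y_lt := by
          show (m.μ b : ℝ) - s * d / 2 < m.μ b - s * d / 4
          linarith
        x_lt := by
          show (m.μ b : ℝ) - s * d / 4 < m.μ b
          linarith
        lt_one := hb1 }
    refine (limsup_regret_le_of_thresholds τ c hc hball hq hq00 hle ν π hπ).trans (le_of_eq ?_)
    congr 1
    refine Finset.sum_congr rfl fun a ha => ?_
    have e : (τ.w a : ℝ) = m.μ a + s * d / 4 := by
      simp only [τ]
      rw [dif_neg (Finset.ne_of_mem_erase ha)]
    rw [e]
  have hlim : Tendsto (fun s : ℝ => ∑ a ∈ Finset.univ.erase b, (m.gap b true a).toReal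
      / klReal (m.μ a + s * d / 4) (m.μ b - s * d / 2)) (nhdsWithin 0 (Set.Ioi 0))
      (nhds (∑ a ∈ Finset.univ.erase b, (m.gap b true a).toReal / klReal (m.μ a) (m.μ b))) := by
    refine tendsto_finsetSum _ fun a ha => ?_
    have hab := Finset.ne_of_mem_erase ha
    have hlt : (m.μ a : ℝ) < m.μ b := by linarith [ha' a hab]
    have hamem : (m.μ a : ℝ) ∈ Set.Ioo (0 : ℝ) 1 := ⟨hpos a, hlt.trans hb1'⟩
    have hbmem : (m.μ b : ℝ) ∈ Set.Ioo (0 : ℝ) 1 := ⟨hpos b, hb1'⟩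
    have hcont : Tendsto (fun s : ℝ => ((m.μ a : ℝ) + s * d / 4, (m.μ b : ℝ) - s * d / 2))
        (nhdsWithin 0 (Set.Ioi 0)) (nhds ((m.μ a : ℝ), (m.μ b : ℝ))) := by
      have : Continuous fun s : ℝ => ((m.μ a : ℝ) + s * d / 4, (m.μ b : ℝ) - s * d / 2) := by
        fun_prop
      have h := this.tendsto 0
      simp only [zero_mul, zero_div, add_zero, sub_zero] at h
      exact h.mono_left nhdsWithin_le_nhds
    exact tendsto_const_nhds.div ((continuousAt_klReal hamem hbmem).tendsto.comp hcont)
      (klReal_pos hamem hbmem hlt.ne).ne'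
  refine ge_of_tendsto ((continuous_coe_real_ereal.tendsto _).comp hlim) ?_
  filter_upwards [Ioo_mem_nhdsGT (show (0 : ℝ) < 1 by norm_num)] with s hs
  exact hsmall s hs

end MABA

/-! ### Assembly of the regret bound -/

theorem theorem2 (M : ℕ) (hM : 2 ≤ M) (m : MABA M)
    -- the arms `a₁`, `a₂` and `a_M`, in order of decreasing mean
    (a₁ a₂ aM : Fin M) (ha₁ : (a₁ : ℕ) = 0) (ha₂ : (a₂ : ℕ) = 1) (haM : (aM : ℕ) = M - 1)
    (hq_mono : ∀ i j i' j' : Bool,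
      i.toNat + j.toNat < i'.toNat + j'.toNat → m.q i' j' ≤ m.q i j)
    (hq00 : 0 < m.q false false)
    (hμ_anti : Antitone m.μ) (hμ_lt_one : m.μ a₁ < 1)
    (hμ_gap : m.μ a₂ < m.μ a₁) (hμ_pos : 0 < m.μ aM)
    (hq01 : m.q false true < 1) (hq11 : m.q true true < 1)
    (hgap : ∀ a, a ≠ a₁ →
      m.V a₁ true - m.Q a₁ true a ≤ m.V a₁ false - m.Q a₁ false a)
    -- the (arbitrary) law of the sequence of initial states of the episodes
    (ν : Measure (ℕ → Bool)) [IsProbabilityMeasure ν]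
    (π : Policy M) (hπ : MABA.IsKLULCB 1 1 4 π) :
    (∀ K, m.expReward ν (fun _ _ => a₁) K ≠ ∞ ∧ m.expReward ν π K ≠ ∞) ∧
    limsup (fun K : ℕ => ((m.regret ν a₁ π K / Real.log K : ℝ) : EReal)) atTop ≤
      ((∑ a ∈ Finset.univ.erase a₁,
        (m.V a₁ true - m.Q a₁ true a) / (MABA.kl (m.μ a) (m.μ a₁)).toReal : ℝ) : EReal) := by
  have hμb : ∀ a, m.μ a ≤ m.μ a₁ := fun a => hμ_anti (by rw [Fin.le_def]; omega)
  have hμM : ∀ a, m.μ aM ≤ m.μ a := fun a => hμ_anti (by rw [Fin.le_def]; omega)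
  have hμ2 : ∀ a, a ≠ a₁ → m.μ a ≤ m.μ a₂ := fun a ha => hμ_anti (by
    have : (a : ℕ) ≠ a₁ := fun h => ha (Fin.ext h)
    rw [Fin.le_def]; omega)
  have hq : ∀ s, m.q s true < 1 := by
    intro s
    cases s
    · exact hq01
    · exact hq11
  -- Three families of comparisons of abandonment probabilities suffice: between the two states
  -- after each reward, and between the two rewards in each state.
  have hle : ∀ s a, m.bellman (m.VE a₁) s a ≤ m.VE a₁ s := fun s a =>
    MABA.bellman_le_VE m a₁ (hq_mono false true true true (by decide))
      (hq_mono false false true false (by decide))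
      (fun s => hq_mono s false s true (by cases s <;> decide)) s a (hμb a)
  have hfin : ∀ s, m.VE a₁ s ≠ ∞ := m.VE_ne_top a₁ hμ_lt_one hq00
  refine ⟨fun K => (MABA.regret_le m a₁ hμb hμ_lt_one hq00 hle ν π K).1, ?_⟩
  refine (MABA.limsup_regret_le a₁ a₂ aM hμM hμ_pos hμ2 hμ_gap hμ_lt_one hq hq00 hle ν π
    hπ).trans (le_of_eq ?_)
  congr 1
  refine Finset.sum_congr rfl fun a _ => ?_
  have hmem : (m.μ a₁ : ℝ) ∈ Set.Ioo (0 : ℝ) 1 := ⟨lt_of_lt_of_le hμ_pos (hμM a₁), hμ_lt_one⟩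
  obtain ⟨hQ, hQfin⟩ := MABA.Q_eq_bellman m a₁ true a hfin
  rw [MABA.kl_eq_ofReal _ _ hmem,
    ENNReal.toReal_ofReal (MABA.klReal_nonneg (m.μ a).2 hmem), MABA.gap,
    ENNReal.toReal_sub_of_le (hle true a) (hfin true), hQ]
  rfl
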